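/- Fix $d\ge 1$ and $T\ge 2$. In each round $t=1,\dots,T$ a learner plays a random unit vector $w_t\in\mathbb R^d$, the environment picks a real $d\times d$ loss matrix $L_t$ of spectral norm at most $1$ (possibly at random, and depending on everything that happened before the learner's randomization in round $t$, but not on that randomization), and the learner observes only the loss $\ell_t=\langle w_tw_t^{\mathsf T},L_t\rangle$, where $\langle A,B\rangle=\operatorname{tr}(A^{\mathsf T}B)$. The regret is $$\mathrm{regret}_T=\max_{\|u\|=1}\sum_{t=1}^T\mathbb E\bigl[\langle w_tw_t^{\mathsf T}-uu^{\mathsf T},L_t\rangle\bigr].$$ The learner uses online mirror descent with dense sampling, with learning rate $\eta=\min\Bigl\{\sqrt{\tfrac{\log T}{dT}},\tfrac1{2d}\Bigr\}$ and exploration rate $\gamma=0$: it starts from $W_1=\tfrac1d I$, and in round $t$ it takes an eigendecomposition $W_t=\sum_{i=1}^d\lambda_iu_iu_i^{\mathsf T}$ with orthonormal $u_1,\dots,u_d$ and tosses a fair coin $B\in\{0,1\}$. If $B=1$, it plays $w_t=u_I$, where $I=i$ with probability $\lambda_i$, and sets $\widetilde L_t=2\ell_t\,W_t^{-1/2}w_tw_t^{\mathsf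 T}W_t^{-1/2}$. If $B=0$, it plays $w_t=\sum_i s_i\sqrt{\lambda_i}\,u_i$ with independent uniform signs $s_i\in\{-1,1\}$, and sets $\widetilde L_t=\ell_t\bigl(W_t^{-1}w_tw_t^{\mathsf T}W_t^{-1}-W_t^{-1}\bigr)$. Finally $W_{t+1}=\bigl(W_t^{-1}+\eta\widetilde L_t+\beta I\bigr)^{-1}$, where $\beta\in\mathbb R$ is such that $W_{t+1}$ is positive definite with $\operatorname{tr}W_{t+1}=1$. Then there is an absolute constant $C>0$ such that, for all $d\ge1$, all $T\ge2$, all environments and all choices of eigendecompositions, $$\mathrm{regret}_T\le C\,d^{3/2}\sqrt{T\log T}.$$ -/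

import Mathlib

open MeasureTheory Matrix

noncomputable section

namespace BanditPCA

/-- The inner product `⟨A, B⟩ = tr (Aᵀ B)` of two real `d × d` matrices. -/
def frobInner {d : ℕ} (A B : Matrix (Fin d) (Fin d) ℝ) : ℝ := (Aᵀ * B).trace

/-- The matrix `w wᵀ`. -/
def outer {d : ℕ} (w : EuclideanSpace ℝ (Fin d)) : Matrix (Fin d) (Fin d) ℝ :=
  Matrix.vecMulVec w.ofLp w.ofLp

/-- The spectral norm of a matrix: its operator norm on Euclidean space. -/
def matrixSpectralNorm {d : ℕ} (A : Matrix (Fin d) (Fin d) ℝ) : ℝ :=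
  ‖Matrix.toEuclideanCLM (n := Fin d) (𝕜 := ℝ) A‖

/-- `W = ∑ᵢ μᵢ uᵢ uᵢᵀ` with orthonormal `u₁, …, u_d`. -/
def IsEigendecomposition {d : ℕ} (W : Matrix (Fin d) (Fin d) ℝ) (μ : Fin d → ℝ)
    (u : Fin d → EuclideanSpace ℝ (Fin d)) : Prop :=
  Orthonormal ℝ u ∧ W = ∑ i, μ i • outer (u i)

/-- The eigenvalues `λ = (1 - γ) μ + γ (1/d, …, 1/d)` of the matrix that is sampled from. -/
def mixedEigenvalues {d : ℕ} (γ : ℝ) (μ : Fin d → ℝ) : Fin d → ℝ :=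
  fun i => (1 - γ) * μ i + γ * (1 / d)

/-- The matrix `(1 - γ) W + (γ / d) I` that is sampled from. -/
def mixedMatrix {d : ℕ} (γ : ℝ) (W : Matrix (Fin d) (Fin d) ℝ) : Matrix (Fin d) (Fin d) ℝ :=
  (1 - γ) • W + (γ / d) • (1 : Matrix (Fin d) (Fin d) ℝ)

/-- The outcome of the learner's coins in one round of dense sampling: `diag i` means
that `B = 1` and `I = i`, and `signs s` means that `B = 0` and that the sign vector is `s`. -/
inductive Draw (d : ℕ) : Type
  | diag (i : Fin d) : Draw d
  | signs (s : Fin d → ℤˣ) : Draw d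

/-- The probability of an outcome: `B` is a fair coin, `I` has law `lam`, and the signs are
independent and uniform. -/
def drawProb {d : ℕ} (lam : Fin d → ℝ) : Draw d → ℝ
  | .diag i => 1 / 2 * lam i
  | .signs _ => 1 / 2 * (1 / 2) ^ d

/-- The vector `w` played by dense sampling. -/
def playedVector {d : ℕ} (lam : Fin d → ℝ) (u : Fin d → EuclideanSpace ℝ (Fin d)) :
    Draw d → EuclideanSpace ℝ (Fin d)
  | .diag i => u i
  | .signs s => ∑ i, (((s i : ℤ) : ℝ) * Real.sqrt (lam i)) • u i

open scoped MatrixOrder in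
/-- The inverse square root `V^{-1/2}` of a positive definite matrix `V`. -/
def invSqrt {d : ℕ} (V : Matrix (Fin d) (Fin d) ℝ) : Matrix (Fin d) (Fin d) ℝ :=
  CFC.sqrt V⁻¹

/-- The loss estimate of dense sampling: `V` is the matrix sampled from, `w` the vector
played and `l` the loss observed. -/
def lossEstimate {d : ℕ} (V : Matrix (Fin d) (Fin d) ℝ) (w : EuclideanSpace ℝ (Fin d)) (l : ℝ) :
    Draw d → Matrix (Fin d) (Fin d) ℝ
  | .diag _ => (2 * l) • (invSqrt V * outer w * invSqrt V)
  | .signs _ => l • (V⁻¹ * outer w * V⁻¹ - V⁻¹)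

/-- `W' = (W⁻¹ + η Lhat + β I)⁻¹`, where `β` is such that `W'` is a (positive definite)
density matrix. There is exactly one such `β`. -/
def IsUpdate {d : ℕ} (η : ℝ) (W Lhat W' : Matrix (Fin d) (Fin d) ℝ) : Prop :=
  W'.PosDef ∧ W'.trace = 1 ∧
    ∃ β : ℝ, W' = (W⁻¹ + η • Lhat + β • (1 : Matrix (Fin d) (Fin d) ℝ))⁻¹

/-- An interaction of `T` rounds (numbered `0, …, T - 1`) between the mirror descent algorithm
for bandit PCA with dense sampling (learning rate `η`, exploration rate `γ`) and a possibly
random, adaptive environment, on a probability space `(Ω, P)`. The σ-algebra `ℱ t` is everything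
that has happened before the learner tosses the coins of round `t`: all earlier coins, all
randomness used by the environment so far, and the loss matrix of round `t`. -/
structure Interaction (d T : ℕ) (η γ : ℝ) {Ω : Type*} [mΩ : MeasurableSpace Ω]
    (P : Measure Ω) where
  /-- the history -/
  ℱ : Filtration ℕ mΩ
  /-- the loss matrices, chosen by the environment -/
  L : ℕ → Ω → Matrix (Fin d) (Fin d) ℝ
  /-- the density matrices, maintained by the learner -/
  W : ℕ → Ω → Matrix (Fin d) (Fin d) ℝ
  /-- the eigenvalues in the eigendecomposition of `W t` that the learner has computed -/
  eigval : ℕ → Ω → Fin d → ℝ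
  /-- the eigenvectors in the eigendecomposition of `W t` that the learner has computed -/
  eigvec : ℕ → Ω → Fin d → EuclideanSpace ℝ (Fin d)
  /-- the coins of the learner -/
  draw : ℕ → Ω → Draw d
  /-- the loss matrix of a round may depend on the whole past, but not on the coins of the
  round -/
  measurable_loss : ∀ t < T, ∀ i j, Measurable[ℱ t] fun ω => L t ω i j
  /-- the loss matrices have spectral norm at most one -/
  loss_le_one : ∀ t < T, ∀ ω, matrixSpectralNorm (L t ω) ≤ 1
  /-- the eigendecomposition is computed before the coins of the round are tossed -/
  measurable_eigval : ∀ t < T, Measurable[ℱ t] (eigval t)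
  measurable_eigvec : ∀ t < T, Measurable[ℱ t] (eigvec t)
  eigendecomposition : ∀ t < T, ∀ ω, IsEigendecomposition (W t ω) (eigval t ω) (eigvec t ω)
  /-- the coins of a round belong to the past of the next round -/
  measurable_draw : ∀ t < T, ∀ x, MeasurableSet[ℱ (t + 1)] (draw t ⁻¹' {x})
  /-- the conditional law of the coins of a round, given the past -/
  law_draw : ∀ t < T, ∀ x, P[(draw t ⁻¹' {x}).indicator (fun _ => (1 : ℝ)) | ℱ t] =ᵐ[P]
    fun ω => drawProb (mixedEigenvalues γ (eigval t ω)) x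
  /-- the initial density matrix is `I / d` -/
  init : ∀ ω, W 0 ω = (1 / d : ℝ) • (1 : Matrix (Fin d) (Fin d) ℝ)
  /-- the update of the density matrix, on the basis of the vector played and of the
  observed loss -/
  update : ∀ t < T, ∀ ω,
    let w := playedVector (mixedEigenvalues γ (eigval t ω)) (eigvec t ω) (draw t ω)
    IsUpdate η (W t ω)
      (lossEstimate (mixedMatrix γ (W t ω)) w (frobInner (outer w) (L t ω)) (draw t ω))
      (W (t + 1) ω)

namespace Interaction

variable {d T : ℕ} {η γ : ℝ} {Ω : Type*} [mΩ : MeasurableSpace Ω] {P : Measure Ω}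

/-- The vector `w t` played by the learner in round `t`. -/
def played (X : Interaction d T η γ P) (t : ℕ) (ω : Ω) : EuclideanSpace ℝ (Fin d) :=
  playedVector (mixedEigenvalues γ (X.eigval t ω)) (X.eigvec t ω) (X.draw t ω)

/-- The expected regret against the fixed unit vector `u`. -/
def regretAgainst (X : Interaction d T η γ P) (u : EuclideanSpace ℝ (Fin d)) : ℝ :=
  ∑ t ∈ Finset.range T, ∫ ω, frobInner (outer (X.played t ω) - outer u) (X.L t ω) ∂P

/-- The regret: the maximum of the expected regret against a fixed unit vector. -/
def regret (X : Interaction d T η γ P) : ℝ :=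
  ⨆ u : Metric.sphere (0 : EuclideanSpace ℝ (Fin d)) 1, X.regretAgainst u

end Interaction

end BanditPCA

end

/-! The update is mirror descent with potential -log det, so the regret on the estimated losses is
bounded by a telescoping sum of log-det divergences plus one stability term per round. The one-step
inequality `IsUpdate.mul_trace_le` comes from log det P + log det R ≤ tr(PR) - d, applied to W⁻¹ +
ηL̃ and the new iterate; the shift β cancels because comparator and iterate both have trace one.

The stability term is invariant under congruence. With W⁻¹ = R Rᵀ and L̃ = R X Rᵀ it becomes η tr X
- log det(1 + ηX), where X is 2ℓ eᵢeᵢᵀ or ℓ(ssᵀ - I), both of explicit spectrum. For d ≥ 2 and ηd ≤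
1/2 all eigenvalues of ηX lie in [-1/2, 1/2], and the term is at most 2η²d² for every outcome of the
coins (`trace_sub_log_det_whiteEstimate_le`). Hence neither a variance computation nor exploration
is needed.

The estimate has conditional mean (L + Lᵀ)/2: in the eigenbasis, eigenvector draws supply the
diagonal and sign draws the off-diagonal entries. Tested against a symmetric matrix this is as good
as L (`sum_drawProb_mul_frobInner`). Integrability rests on a uniform bound for tr W⁻¹
(`exists_trace_inv_le`).

For d ≥ 2 the matrix uuᵀ is singular and at infinite divergence, so the comparator is smoothed with
weight 1/T; its divergence from I/d is at most d log T, and smoothing costs at most 2 in total. This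
gives d log T/η + 2ηd²T + 2. The first choice of η balances the terms; when η = 1/(2d) is the
smaller one, T is so small that the trivial bound 2T suffices. For d = 1 the regret vanishes. -/

noncomputable section

namespace BanditPCA

variable {d : ℕ}

/-! ### The log-det divergence and one step of mirror descent -/

/-- The log-determinant inequality, equivalent to nonnegativity of the log-det divergence. -/
lemma log_det_add_log_det_le {P R : Matrix (Fin d) (Fin d) ℝ} (hP : P.PosDef) (hR : R.PosDef) :
    Real.log P.det + Real.log R.det ≤ (P * R).trace - d := by
  obtain ⟨B, hB⟩ : ∃ B : Matrix (Fin d) (Fin d) ℝ, P = Bᴴ * B := by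
    open scoped MatrixOrder in
    exact CStarAlgebra.nonneg_iff_eq_star_mul_self.mp
      (Matrix.nonneg_iff_posSemidef.mpr hP.posSemidef)
  have hdetB : B.det ≠ 0 := by
    intro h
    have := hP.det_pos
    rw [hB, det_mul, h, mul_zero] at this
    exact lt_irrefl _ this
  have hinj : Function.Injective Bᴴ.mulVec := by
    apply Matrix.mulVec_injective_of_isUnit
    rw [Matrix.isUnit_iff_isUnit_det, det_conjTranspose]
    simpa using hdetB
  -- `P * R` need not be symmetric, but this matrix is, with the same trace and determinant. The
  -- claim is log x ≤ x - 1 summed over its eigenvalues.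
  have hS : (B * R * Bᴴ).PosDef := by
    refine hR.mul_mul_conjTranspose_same ?_
    apply Matrix.vecMul_injective_of_isUnit
    rw [Matrix.isUnit_iff_isUnit_det]
    simpa using hdetB
  have htr : (P * R).trace = (B * R * Bᴴ).trace := by
    rw [hB, Matrix.trace_mul_comm (B * R), Matrix.mul_assoc]
  have hdet : P.det * R.det = (B * R * Bᴴ).det := by
    rw [hB]; simp only [det_mul]; ring
  rw [← Real.log_mul hP.det_pos.ne' hR.det_pos.ne', hdet, htr,
    hS.1.det_eq_prod_eigenvalues, hS.1.trace_eq_sum_eigenvalues]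
  simp only [RCLike.ofReal_real_eq_id, id]
  rw [Real.log_prod (fun i _ => (hS.eigenvalues_pos i).ne')]
  calc ∑ i, Real.log (hS.1.eigenvalues i) ≤ ∑ i, (hS.1.eigenvalues i - 1) :=
        Finset.sum_le_sum fun i _ => Real.log_le_sub_one_of_pos (hS.eigenvalues_pos i)
    _ = _ := by simp [Finset.sum_sub_distrib]

/-- The log-det divergence of `U` from `W`. -/
def logDetDiv (U W : Matrix (Fin d) (Fin d) ℝ) : ℝ :=
  (U * W⁻¹).trace - Real.log U.det + Real.log W.det - d

lemma log_det_inv {W : Matrix (Fin d) (Fin d) ℝ} : Real.log W⁻¹.det = -Real.log W.det := by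
  rw [Matrix.det_nonsing_inv, Ring.inverse_eq_inv', Real.log_inv]

lemma logDetDiv_nonneg {U W : Matrix (Fin d) (Fin d) ℝ} (hU : U.PosDef) (hW : W.PosDef) :
    0 ≤ logDetDiv U W := by
  have := log_det_add_log_det_le hU hW.inv
  rw [log_det_inv] at this
  unfold logDetDiv; linarith

lemma inv_mul_self_of_posDef {W : Matrix (Fin d) (Fin d) ℝ} (hW : W.PosDef) : W⁻¹ * W = 1 :=
  Matrix.nonsing_inv_mul _ ((Matrix.isUnit_iff_isUnit_det _).mp hW.isUnit)

lemma mul_inv_self_of_posDef {W : Matrix (Fin d) (Fin d) ℝ} (hW : W.PosDef) : W * W⁻¹ = 1 :=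
  Matrix.mul_nonsing_inv _ ((Matrix.isUnit_iff_isUnit_det _).mp hW.isUnit)

lemma IsUpdate.exists_inv_eq {η : ℝ} {W M W' : Matrix (Fin d) (Fin d) ℝ}
    (h : IsUpdate η W M W') :
    ∃ β : ℝ, W'⁻¹ = W⁻¹ + η • M + β • (1 : Matrix (Fin d) (Fin d) ℝ) := by
  obtain ⟨hpos, -, β, hβ⟩ := h
  refine ⟨β, ?_⟩
  have hu : IsUnit (W⁻¹ + η • M + β • (1 : Matrix (Fin d) (Fin d) ℝ)).det := by
    have := hpos.inv.isUnit
    have h2 := (Matrix.isUnit_iff_isUnit_det _).mp hpos.isUnit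
    rw [hβ, Matrix.isUnit_nonsing_inv_det_iff] at h2
    exact h2
  rw [hβ, Matrix.nonsing_inv_nonsing_inv _ hu]

/-- One step of mirror descent, with the log-det divergence as a potential. -/
lemma IsUpdate.mul_trace_le {η : ℝ} {U W M W' : Matrix (Fin d) (Fin d) ℝ}
    (h : IsUpdate η W M W') (hW : W.PosDef) (htU : U.trace = 1)
    (hA : (W⁻¹ + η • M).PosDef) :
    η * ((W - U) * M).trace ≤ logDetDiv U W - logDetDiv U W' +
      ((W * (W⁻¹ + η • M)).trace - Real.log W.det - Real.log (W⁻¹ + η • M).det - d) := by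
  obtain ⟨β, hβ⟩ := h.exists_inv_eq
  -- The right-hand side will equal -β, and `h2` produces +β; the unknown shift disappears on
  -- adding.
  have hKL := log_det_add_log_det_le hA h.1
  have h1 : (W⁻¹ + η • M) * W' = 1 - β • W' := by
    have : W'⁻¹ * W' = 1 := inv_mul_self_of_posDef h.1
    rw [hβ, add_mul, smul_mul_assoc, one_mul] at this
    exact eq_sub_of_add_eq this
  rw [h1, trace_sub, trace_smul, h.2.1, trace_one] at hKL
  have h2 : (U * W'⁻¹).trace = (U * W⁻¹).trace + η * (U * M).trace + β := by
    rw [hβ]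
    simp [mul_add, trace_add, trace_smul, htU]
  have h3 : (W * (W⁻¹ + η • M)).trace = d + η * (W * M).trace := by
    simp [mul_add, trace_add, trace_smul, mul_inv_self_of_posDef hW]
  unfold logDetDiv
  rw [h2, h3, sub_mul, trace_sub]
  simp at hKL
  linarith

/-- The normalizing shift is at most `d`. -/
lemma IsUpdate.trace_inv_le {η : ℝ} {W M W' : Matrix (Fin d) (Fin d) ℝ}
    (h : IsUpdate η W M W') (hA : (W⁻¹ + η • M).PosDef) :
    W'⁻¹.trace ≤ W⁻¹.trace + η * M.trace + d * d := by
  obtain ⟨β, hβ⟩ := h.exists_inv_eq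
  have hW' := h.1
  have hH : W'ᴴ = W' := hW'.1
  have hT : W'ᵀ = W' := by simpa using hH
  -- This trace equals 1 - β tr(W'²), so β ≤ 1 / tr(W'²) ≤ d, the last step by Cauchy-Schwarz on the
  -- diagonal of `W'`.
  have h0 : 0 ≤ (W' * (W⁻¹ + η • M) * W').trace := by
    have := (hA.posSemidef.mul_mul_conjTranspose_same W').trace_nonneg
    rwa [hH] at this
  have h1 : W' * (W⁻¹ + η • M) * W' = W' - β • (W' * W') := by
    have : W' * W'⁻¹ * W' = W' := by rw [mul_inv_self_of_posDef hW', one_mul]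
    rw [hβ, mul_add, add_mul, mul_smul_comm, mul_one, smul_mul_assoc] at this
    exact eq_sub_of_add_eq this
  rw [h1, trace_sub, trace_smul, h.2.1] at h0
  have hcs : 1 ≤ d * (W' * W').trace := by
    have e1 : (W' * W').trace = ∑ i, ∑ j, W' i j ^ 2 := by
      simp only [trace, diag_apply, mul_apply]
      refine Finset.sum_congr rfl fun i _ => Finset.sum_congr rfl fun j _ => ?_
      rw [show W' j i = W' i j by conv_lhs => rw [← hT, transpose_apply]]; ring
    have e2 : ∑ i, W' i i ^ 2 ≤ (W' * W').trace := by
      rw [e1]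
      exact Finset.sum_le_sum fun i _ =>
        Finset.single_le_sum (f := fun j => W' i j ^ 2) (fun j _ => sq_nonneg _)
          (Finset.mem_univ i)
    have e3 := sq_sum_le_card_mul_sum_sq (s := Finset.univ) (f := fun i => W' i i)
    have e4 : ∑ i, W' i i = 1 := h.2.1
    rw [e4] at e3
    simp at e3
    nlinarith [(Nat.cast_nonneg d : (0:ℝ) ≤ d)]
  have hβd : β ≤ d := by
    have ht : 0 ≤ (W' * W').trace := by
      by_contra hc
      nlinarith [(Nat.cast_nonneg d : (0:ℝ) ≤ d)]
    simp only [smul_eq_mul] at h0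
    by_contra! hc
    have : 0 < (W' * W').trace := by
      rcases ht.lt_or_eq with h | h
      · exact h
      · rw [← h] at hcs; norm_num at hcs
    nlinarith
  rw [hβ]
  simp only [trace_add, trace_smul, trace_one, smul_eq_mul, Fintype.card_fin]
  nlinarith [(Nat.cast_nonneg d : (0:ℝ) ≤ d)]

/-! ### Scalar, determinant and quadratic form estimates -/

lemma sub_log_one_add_le {x : ℝ} (hx : |x| ≤ 1 / 2) : x - Real.log (1 + x) ≤ 2 * x ^ 2 := by
  obtain ⟨h1, h2⟩ := abs_le.mp hx
  have hp : 0 < 1 + x := by linarith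
  have h3 := Real.one_sub_inv_le_log_of_pos hp
  have h4 : x - 1 + (1 + x)⁻¹ ≤ 2 * x ^ 2 := by
    have : x - 1 + (1 + x)⁻¹ = x ^ 2 / (1 + x) := by field_simp; ring
    rw [this, div_le_iff₀ hp]
    nlinarith [sq_nonneg x]
  linarith

lemma det_smul_one_add_smul_vecMulVec (a b : ℝ) (ha : a ≠ 0) (v : Fin d → ℝ) :
    (a • (1 : Matrix (Fin d) (Fin d) ℝ) + b • vecMulVec v v).det
      = a ^ d * (1 + b / a * (v ⬝ᵥ v)) := by
  have : a • (1 : Matrix (Fin d) (Fin d) ℝ) + b • vecMulVec v v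
      = a • (1 + replicateCol Unit ((b / a) • v) * replicateRow Unit v) := by
    rw [smul_add, ← vecMulVec_eq, smul_vecMulVec, smul_smul, mul_div_cancel₀ _ ha]
  rw [this, det_smul, det_one_add_replicateCol_mul_replicateRow]
  simp

lemma frobInner_outer (w : EuclideanSpace ℝ (Fin d)) (A : Matrix (Fin d) (Fin d) ℝ) :
    frobInner (outer w) A = w.ofLp ⬝ᵥ A *ᵥ w.ofLp := by
  simp only [frobInner, outer, transpose_vecMulVec, vecMulVec_mul, trace_vecMulVec,
    dotProduct_mulVec]
  rw [dotProduct_comm]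

lemma abs_frobInner_outer_le (w : EuclideanSpace ℝ (Fin d)) (A : Matrix (Fin d) (Fin d) ℝ) :
    |frobInner (outer w) A| ≤ ‖w‖ ^ 2 * matrixSpectralNorm A := by
  rw [frobInner_outer, ← Matrix.inner_toEuclideanCLM]
  refine (abs_real_inner_le_norm _ _).trans ?_
  have := (Matrix.toEuclideanCLM (n := Fin d) (𝕜 := ℝ) A).le_opNorm w
  unfold matrixSpectralNorm
  nlinarith [norm_nonneg w]

/-! ### Eigenbasis coordinates and whitening of the loss estimate -/

/-- The matrix whose columns are the vectors `u i`. -/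
def colMatrix (u : Fin d → EuclideanSpace ℝ (Fin d)) : Matrix (Fin d) (Fin d) ℝ :=
  Matrix.of fun i j => u j i

lemma colMatrix_transpose_mul {u : Fin d → EuclideanSpace ℝ (Fin d)} (hu : Orthonormal ℝ u) :
    (colMatrix u)ᵀ * colMatrix u = 1 := by
  ext i j
  have := (orthonormal_iff_ite.mp hu) i j
  rw [Matrix.one_apply, ← this, Matrix.mul_apply]
  simp [colMatrix, PiLp.inner_apply, mul_comm]

lemma colMatrix_mul_transpose {u : Fin d → EuclideanSpace ℝ (Fin d)} (hu : Orthonormal ℝ u) :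
    colMatrix u * (colMatrix u)ᵀ = 1 :=
  mul_eq_one_comm.mp (colMatrix_transpose_mul hu)

lemma IsEigendecomposition.eq_mul {W : Matrix (Fin d) (Fin d) ℝ} {μ : Fin d → ℝ}
    {u : Fin d → EuclideanSpace ℝ (Fin d)} (h : IsEigendecomposition W μ u) :
    W = colMatrix u * diagonal μ * (colMatrix u)ᵀ := by
  rw [h.2]
  ext i j
  rw [Matrix.sum_apply, Matrix.mul_apply]
  refine Finset.sum_congr rfl fun k _ => ?_
  simp [outer, vecMulVec_apply, colMatrix, mul_diagonal]
  ring

lemma IsEigendecomposition.eigval_pos {W : Matrix (Fin d) (Fin d) ℝ} {μ : Fin d → ℝ}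
    {u : Fin d → EuclideanSpace ℝ (Fin d)} (h : IsEigendecomposition W μ u) (hW : W.PosDef)
    (i : Fin d) : 0 < μ i := by
  have h1 : diagonal μ = (colMatrix u)ᵀ * W * colMatrix u := by
    rw [h.eq_mul]
    calc diagonal μ = 1 * diagonal μ * 1 := by simp
      _ = _ := by rw [← colMatrix_transpose_mul h.1]; simp only [Matrix.mul_assoc]
  have h2 : (diagonal μ).PosDef := by
    rw [h1]
    refine hW.conjTranspose_mul_mul_same (B := colMatrix u) ?_
    apply Matrix.mulVec_injective_of_isUnit
    exact IsUnit.of_mul_eq_one _ (colMatrix_mul_transpose h.1)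
  exact Matrix.posDef_diagonal_iff.mp h2 i

lemma IsEigendecomposition.trace_eq {W : Matrix (Fin d) (Fin d) ℝ} {μ : Fin d → ℝ}
    {u : Fin d → EuclideanSpace ℝ (Fin d)} (h : IsEigendecomposition W μ u) :
    W.trace = ∑ i, μ i := by
  rw [h.eq_mul, Matrix.trace_mul_comm, ← Matrix.mul_assoc, colMatrix_transpose_mul h.1]
  simp

/-- The factor `R` of `W⁻¹ = R Rᵀ`. -/
def invFactor (μ : Fin d → ℝ) (u : Fin d → EuclideanSpace ℝ (Fin d)) :
    Matrix (Fin d) (Fin d) ℝ :=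
  colMatrix u * diagonal fun i => (Real.sqrt (μ i))⁻¹

lemma diagonal_mul_sqrt_inv {μ : Fin d → ℝ} (hμ : ∀ i, 0 < μ i) :
    diagonal (fun i => (Real.sqrt (μ i))⁻¹) * diagonal (fun i => (Real.sqrt (μ i))⁻¹)
      = diagonal fun i => (μ i)⁻¹ := by
  rw [diagonal_mul_diagonal]
  congr 1; ext i
  rw [← mul_inv, Real.mul_self_sqrt (hμ i).le]

lemma IsEigendecomposition.inv_eq {W : Matrix (Fin d) (Fin d) ℝ} {μ : Fin d → ℝ}
    {u : Fin d → EuclideanSpace ℝ (Fin d)} (h : IsEigendecomposition W μ u)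
    (hμ : ∀ i, 0 < μ i) :
    W⁻¹ = colMatrix u * (diagonal fun i => (μ i)⁻¹) * (colMatrix u)ᵀ := by
  apply Matrix.inv_eq_right_inv
  rw [h.eq_mul]
  have h1 : diagonal μ * (diagonal fun i => (μ i)⁻¹) = 1 := by
    rw [diagonal_mul_diagonal, ← diagonal_one]
    congr 1; ext i; exact mul_inv_cancel₀ (hμ i).ne'
  calc _ = colMatrix u * diagonal μ * ((colMatrix u)ᵀ * colMatrix u) *
        (diagonal fun i => (μ i)⁻¹) * (colMatrix u)ᵀ := by simp only [Matrix.mul_assoc]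
    _ = colMatrix u * (diagonal μ * (diagonal fun i => (μ i)⁻¹)) * (colMatrix u)ᵀ := by
        rw [colMatrix_transpose_mul h.1]; simp only [Matrix.mul_assoc, Matrix.one_mul]
    _ = 1 := by rw [h1, Matrix.mul_one, colMatrix_mul_transpose h.1]

lemma IsEigendecomposition.inv_eq_factor {W : Matrix (Fin d) (Fin d) ℝ} {μ : Fin d → ℝ}
    {u : Fin d → EuclideanSpace ℝ (Fin d)} (h : IsEigendecomposition W μ u)
    (hμ : ∀ i, 0 < μ i) : W⁻¹ = invFactor μ u * (invFactor μ u)ᵀ := by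
  rw [h.inv_eq hμ, invFactor, transpose_mul, diagonal_transpose, ← diagonal_mul_sqrt_inv hμ]
  simp only [Matrix.mul_assoc]

/-- The positive square root is unique, and U Λ^{-1/2} Uᵀ is one. The non-symmetric factor U
Λ^{-1/2} differs from it only by an orthogonal matrix, which turns eigenvectors into coordinate
vectors. -/
lemma IsEigendecomposition.invSqrt_eq {W : Matrix (Fin d) (Fin d) ℝ} {μ : Fin d → ℝ}
    {u : Fin d → EuclideanSpace ℝ (Fin d)} (h : IsEigendecomposition W μ u)
    (hμ : ∀ i, 0 < μ i) : invSqrt W = invFactor μ u * (colMatrix u)ᵀ := by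
  open scoped MatrixOrder in
  apply CFC.sqrt_unique
  · rw [h.inv_eq hμ, invFactor, ← diagonal_mul_sqrt_inv hμ]
    calc _ = colMatrix u * (diagonal fun i => (Real.sqrt (μ i))⁻¹) *
          ((colMatrix u)ᵀ * colMatrix u) * (diagonal fun i => (Real.sqrt (μ i))⁻¹) *
          (colMatrix u)ᵀ := by simp only [Matrix.mul_assoc]
      _ = _ := by rw [colMatrix_transpose_mul h.1]; simp only [Matrix.mul_assoc, Matrix.one_mul]
  · rw [Matrix.nonneg_iff_posSemidef, invFactor]
    refine (PosSemidef.diagonal ?_).mul_mul_conjTranspose_same _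
    intro i; exact inv_nonneg.mpr (Real.sqrt_nonneg _)

/-- The coordinates of the played vector in the eigenbasis. -/
def playedCoord (μ : Fin d → ℝ) : Draw d → Fin d → ℝ
  | .diag i => Pi.single i 1
  | .signs s => fun i => ((s i : ℤ) : ℝ) * Real.sqrt (μ i)

lemma ofLp_playedVector (μ : Fin d → ℝ) (u : Fin d → EuclideanSpace ℝ (Fin d)) (x : Draw d) :
    (playedVector μ u x).ofLp = colMatrix u *ᵥ playedCoord μ x := by
  cases x with
  | diag i => ext k; simp [playedVector, playedCoord, colMatrix]
  | signs s =>
    ext k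
    simp [playedVector, playedCoord, colMatrix, mulVec, dotProduct, mul_comm]

/-- The observed loss in terms of the loss matrix in the eigenbasis. -/
def coordLoss (μ : Fin d → ℝ) (K : Matrix (Fin d) (Fin d) ℝ) (x : Draw d) : ℝ :=
  playedCoord μ x ⬝ᵥ K *ᵥ playedCoord μ x

lemma frobInner_outer_playedVector (μ : Fin d → ℝ) (u : Fin d → EuclideanSpace ℝ (Fin d))
    (A : Matrix (Fin d) (Fin d) ℝ) (x : Draw d) :
    frobInner (outer (playedVector μ u x)) A
      = coordLoss μ ((colMatrix u)ᵀ * A * colMatrix u) x := by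
  rw [frobInner_outer, ofLp_playedVector, coordLoss, dotProduct_comm, dotProduct_mulVec,
    dotProduct_comm, ← mulVec_transpose, dotProduct_comm]
  simp only [mulVec_mulVec, Matrix.mul_assoc]
  exact dotProduct_comm _ _

lemma norm_playedVector {μ : Fin d → ℝ} {u : Fin d → EuclideanSpace ℝ (Fin d)}
    (hu : Orthonormal ℝ u) (hμ : ∀ i, 0 ≤ μ i) (hsum : ∑ i, μ i = 1) (x : Draw d) :
    ‖playedVector μ u x‖ = 1 := by
  cases x with
  | diag i => exact hu.1 i
  | signs s =>
    have h : ‖playedVector μ u (.signs s)‖ ^ 2 = 1 := by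
      rw [← real_inner_self_eq_norm_sq, playedVector, hu.inner_sum, ← hsum]
      refine Finset.sum_congr rfl fun i _ => ?_
      have h1 : (((s i : ℤ) : ℝ)) * ((s i : ℤ) : ℝ) = 1 := by
        rcases Int.units_eq_one_or (s i) with h | h <;> simp [h]
      have h2 := Real.mul_self_sqrt (hμ i)
      simp only [conj_trivial]
      linear_combination (Real.sqrt (μ i) * Real.sqrt (μ i)) * h1 + h2
    nlinarith [norm_nonneg (playedVector μ u (.signs s))]

/-- The loss estimate, whitened: `Lhat = R X Rᵀ`. -/
def whiteEstimate (l : ℝ) : Draw d → Matrix (Fin d) (Fin d) ℝ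
  | .diag i => (2 * l) • vecMulVec (Pi.single i 1) (Pi.single i 1)
  | .signs s => l • (vecMulVec (fun i => ((s i : ℤ) : ℝ)) (fun i => ((s i : ℤ) : ℝ)) - 1)

lemma mul_outer_mul {M : Matrix (Fin d) (Fin d) ℝ} {w : EuclideanSpace ℝ (Fin d)} :
    M * outer w * Mᵀ = vecMulVec (M *ᵥ w.ofLp) (M *ᵥ w.ofLp) := by
  rw [outer, mul_vecMulVec, vecMulVec_mul, vecMul_transpose]

/-- In both branches the vector in the rank-one term is R applied to something free of W: W^{-1/2}uᵢ
= R eᵢ, and W⁻¹w = R s for the sign vector s. This removes all dependence on the spectrum of W from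
the stability term. -/
lemma IsEigendecomposition.lossEstimate_eq {W : Matrix (Fin d) (Fin d) ℝ} {μ : Fin d → ℝ}
    {u : Fin d → EuclideanSpace ℝ (Fin d)} (h : IsEigendecomposition W μ u)
    (hμ : ∀ i, 0 < μ i) (l : ℝ) (x : Draw d) :
    lossEstimate W (playedVector μ u x) l x
      = invFactor μ u * whiteEstimate l x * (invFactor μ u)ᵀ := by
  have hconj : ∀ v : Fin d → ℝ, invFactor μ u * vecMulVec v v * (invFactor μ u)ᵀ
      = vecMulVec (invFactor μ u *ᵥ v) (invFactor μ u *ᵥ v) := by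
    intro v; rw [mul_vecMulVec, vecMulVec_mul, vecMul_transpose]
  cases x with
  | diag i =>
    have hT : (invSqrt W)ᵀ = invSqrt W := by
      rw [h.invSqrt_eq hμ, invFactor]; simp [transpose_mul, Matrix.mul_assoc]
    simp only [lossEstimate, whiteEstimate, mul_smul_comm, smul_mul_assoc]
    rw [hconj]
    nth_rewrite 2 [← hT]
    rw [mul_outer_mul, ofLp_playedVector, h.invSqrt_eq hμ, mulVec_mulVec, Matrix.mul_assoc,
      colMatrix_transpose_mul h.1, Matrix.mul_one]
    rfl
  | signs s =>
    have hT : (W⁻¹)ᵀ = W⁻¹ := by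
      rw [h.inv_eq_factor hμ]; simp [transpose_mul]
    simp only [lossEstimate, whiteEstimate, mul_smul_comm, smul_mul_assoc, mul_sub, sub_mul,
      Matrix.mul_one]
    rw [hconj, ← h.inv_eq_factor hμ]
    nth_rewrite 2 [← hT]
    rw [mul_outer_mul, ofLp_playedVector]
    have : W⁻¹ *ᵥ (colMatrix u *ᵥ playedCoord μ (.signs s))
        = invFactor μ u *ᵥ fun i => ((s i : ℤ) : ℝ) := by
      rw [mulVec_mulVec, h.inv_eq hμ, Matrix.mul_assoc, colMatrix_transpose_mul h.1,
        Matrix.mul_one, invFactor, ← mulVec_mulVec, ← mulVec_mulVec]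
      congr 1
      ext i
      have h1 := Real.mul_self_sqrt (hμ i).le
      have h2 := (Real.sqrt_pos.mpr (hμ i)).ne'
      simp only [mulVec_diagonal, playedCoord]
      rw [← h1]
      field_simp
      simp
    rw [this]

/-! ### Positivity and stability in white coordinates -/

lemma posDef_smul_one_add_smul_vecMulVec {a b : ℝ} {v : Fin d → ℝ} (ha : 0 < a)
    (hab : 0 < a + b * (v ⬝ᵥ v)) :
    (a • (1 : Matrix (Fin d) (Fin d) ℝ) + b • vecMulVec v v).PosDef := by
  refine PosDef.of_dotProduct_mulVec_pos ?_ fun {x} hx => ?_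
  · simp [IsHermitian, conjTranspose_eq_transpose_of_trivial, transpose_vecMulVec]
  · have h1 : 0 < x ⬝ᵥ x := by
      have := Matrix.dotProduct_star_self_pos_iff.mpr hx
      simpa using this
    have h2 : (v ⬝ᵥ x) ^ 2 ≤ (v ⬝ᵥ v) * (x ⬝ᵥ x) := by
      have := Finset.sum_mul_sq_le_sq_mul_sq Finset.univ v x
      simpa [dotProduct, sq] using this
    have h3 : star x ⬝ᵥ (a • (1 : Matrix (Fin d) (Fin d) ℝ) + b • vecMulVec v v) *ᵥ x
        = a * (x ⬝ᵥ x) + b * (v ⬝ᵥ x) ^ 2 := by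
      simp only [star_trivial, add_mulVec, smul_mulVec, one_mulVec, vecMulVec_mulVec,
        dotProduct_add, dotProduct_smul, smul_eq_mul, op_smul_eq_smul]
      rw [dotProduct_comm x v]; ring
    rw [h3]
    rcases le_or_gt 0 b with hb | hb
    · positivity
    · nlinarith [mul_pos hab h1]

lemma sign_mul_self (s : ℤˣ) : ((s : ℤ) : ℝ) * ((s : ℤ) : ℝ) = 1 := by
  rcases Int.units_eq_one_or s with h | h <;> simp [h]

lemma one_add_smul_whiteEstimate_diag (η l : ℝ) (i : Fin d) :
    1 + η • whiteEstimate l (.diag i) = (1 : ℝ) • (1 : Matrix (Fin d) (Fin d) ℝ) +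
      (2 * (η * l)) • vecMulVec (Pi.single i 1) (Pi.single i 1) := by
  rw [whiteEstimate, smul_smul, one_smul]; congr 2; ring

lemma one_add_smul_whiteEstimate_signs (η l : ℝ) (s : Fin d → ℤˣ) :
    1 + η • whiteEstimate l (.signs s) = (1 - η * l) • (1 : Matrix (Fin d) (Fin d) ℝ) +
      (η * l) • vecMulVec (fun i => ((s i : ℤ) : ℝ)) (fun i => ((s i : ℤ) : ℝ)) := by
  rw [whiteEstimate, smul_smul, smul_sub, sub_smul, one_smul]; abel

lemma dotProduct_signs (s : Fin d → ℤˣ) :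
    (fun i => ((s i : ℤ) : ℝ)) ⬝ᵥ (fun i => ((s i : ℤ) : ℝ)) = d := by
  simp [dotProduct, sign_mul_self]

lemma trace_whiteEstimate_diag (l : ℝ) (i : Fin d) :
    (whiteEstimate l (.diag i)).trace = 2 * l := by
  simp [whiteEstimate, trace_vecMulVec]

lemma trace_whiteEstimate_signs (l : ℝ) (s : Fin d → ℤˣ) :
    (whiteEstimate l (.signs s)).trace = 0 := by
  simp [whiteEstimate, trace_vecMulVec, dotProduct_signs]

lemma abs_mul_mul_le_half {η l : ℝ} (hη : 0 < η) (hηd : η * d ≤ 1 / 2) (hl : |l| ≤ 1) {c : ℝ}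
    (hc : 0 ≤ c) (hcd : c ≤ d) : |c * (η * l)| ≤ 1 / 2 := by
  rw [abs_mul, abs_mul, abs_of_nonneg hc, abs_of_pos hη]
  have := abs_nonneg l
  calc c * (η * |l|) ≤ d * (η * 1) := by gcongr
    _ ≤ 1 / 2 := by linarith

/-- The eigenvalues that matter are 1 + 2ηℓ for an eigenvector draw, 1 - ηℓ and 1 + (d - 1)ηℓ for a
sign draw. The factor 2 in the first is why d ≥ 2 is needed: only then does ηd ≤ 1/2 control it. -/
lemma posDef_one_add_smul_whiteEstimate (hd : 2 ≤ d) {η l : ℝ} (hη : 0 < η)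
    (hηd : η * d ≤ 1 / 2) (hl : |l| ≤ 1) (x : Draw d) :
    (1 + η • whiteEstimate l x).PosDef := by
  have hd' : (2 : ℝ) ≤ d := by exact_mod_cast hd
  cases x with
  | diag i =>
    rw [one_add_smul_whiteEstimate_diag]
    have := (abs_le.mp (abs_mul_mul_le_half hη hηd hl zero_le_two hd')).1
    apply posDef_smul_one_add_smul_vecMulVec one_pos
    simp; linarith
  | signs s =>
    rw [one_add_smul_whiteEstimate_signs]
    have h1 := (abs_le.mp (abs_mul_mul_le_half hη hηd hl zero_le_one (by linarith))).2
    have h2 := (abs_le.mp (abs_mul_mul_le_half (c := d - 1) hη hηd hl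
      (by linarith) (by linarith))).1
    apply posDef_smul_one_add_smul_vecMulVec (by linarith)
    rw [dotProduct_signs]; linarith

/-- The stability term of one round. -/
lemma trace_sub_log_det_whiteEstimate_le (hd : 2 ≤ d) {η l : ℝ} (hη : 0 < η)
    (hηd : η * d ≤ 1 / 2) (hl : |l| ≤ 1) (x : Draw d) :
    η * (whiteEstimate l x).trace - Real.log (1 + η • whiteEstimate l x).det
      ≤ 2 * η ^ 2 * d ^ 2 := by
  have hd' : (2 : ℝ) ≤ d := by exact_mod_cast hd
  have hl2 : l ^ 2 ≤ 1 := by rw [← sq_abs]; exact pow_le_one₀ (abs_nonneg l) hl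
  have hη2 := sq_nonneg η
  cases x with
  | diag i =>
    rw [one_add_smul_whiteEstimate_diag, trace_whiteEstimate_diag,
      det_smul_one_add_smul_vecMulVec _ _ one_ne_zero]
    have := sub_log_one_add_le (abs_mul_mul_le_half hη hηd hl zero_le_two hd')
    simp only [one_pow, div_one, one_mul, dotProduct_single, Pi.single_eq_same, mul_one]
    calc _ ≤ 2 * (2 * (η * l)) ^ 2 := by linarith
      _ = 2 * η ^ 2 * (2 ^ 2 * l ^ 2) := by ring
      _ ≤ 2 * η ^ 2 * (d ^ 2 * 1) := by gcongr
      _ = _ := by ring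
  | signs s =>
    have h1 := abs_mul_mul_le_half hη hηd hl zero_le_one (by linarith)
    have h2 := abs_mul_mul_le_half (c := d - 1) hη hηd hl (by linarith) (by linarith)
    have hp1 : 0 < 1 - η * l := by linarith [(abs_le.mp h1).2]
    have hp2 : 0 < 1 + (d - 1) * (η * l) := by linarith [(abs_le.mp h2).1]
    rw [one_add_smul_whiteEstimate_signs, trace_whiteEstimate_signs,
      det_smul_one_add_smul_vecMulVec _ _ hp1.ne', dotProduct_signs]
    -- The determinant is split into eigenvalues: 1 - ηℓ with multiplicity d - 1, and 1 + (d - 1)ηℓ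
    -- once.
    have h3 : (1 - η * l) ^ d * (1 + η * l / (1 - η * l) * d)
        = (1 - η * l) ^ (d - 1) * (1 + (d - 1) * (η * l)) := by
      obtain ⟨n, rfl⟩ : ∃ n, d = n + 1 := ⟨d - 1, by omega⟩
      simp only [add_tsub_cancel_right, pow_succ]
      field_simp
      ring
    rw [h3, Real.log_mul (by positivity) hp2.ne', Real.log_pow, Nat.cast_sub (by omega)]
    have h4 := sub_log_one_add_le (x := -(η * l)) (by rw [abs_neg]; simpa using h1)
    have h5 := sub_log_one_add_le h2
    rw [← sub_eq_add_neg] at h4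
    -- The linear terms -(d - 1)ηℓ and (d - 1)ηℓ of the two logarithm bounds cancel, in accordance
    -- with the zero trace.
    have h6 := mul_le_mul_of_nonneg_left h4 (show (0 : ℝ) ≤ d - 1 by linarith)
    push_cast
    calc _ ≤ (d - 1) * (2 * (-(η * l)) ^ 2) + 2 * ((d - 1) * (η * l)) ^ 2 := by linarith
      _ = 2 * η ^ 2 * ((d * d - d) * l ^ 2) := by ring
      _ ≤ 2 * η ^ 2 * (d ^ 2 * 1) := by
        gcongr
        · linarith
      _ = _ := by ring

/-! ### From white coordinates back to the density matrix -/

section Eigendecomposition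

variable {W : Matrix (Fin d) (Fin d) ℝ} {μ : Fin d → ℝ} {u : Fin d → EuclideanSpace ℝ (Fin d)}

lemma IsEigendecomposition.transpose_invFactor_mul (h : IsEigendecomposition W μ u)
    (hW : W.PosDef) : (invFactor μ u)ᵀ * W * invFactor μ u = 1 := by
  have h1 := inv_mul_self_of_posDef hW
  rw [h.inv_eq_factor (h.eigval_pos hW), Matrix.mul_assoc] at h1
  exact mul_eq_one_comm.mp h1

lemma transpose_invFactor_mul_self (hu : Orthonormal ℝ u) (hμ : ∀ i, 0 < μ i) :
    (invFactor μ u)ᵀ * invFactor μ u = diagonal fun i => (μ i)⁻¹ := by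
  rw [invFactor, transpose_mul, diagonal_transpose, ← diagonal_mul_sqrt_inv hμ, Matrix.mul_assoc,
    ← Matrix.mul_assoc (colMatrix u)ᵀ, colMatrix_transpose_mul hu, Matrix.one_mul]

lemma IsEigendecomposition.trace_inv (h : IsEigendecomposition W μ u) (hW : W.PosDef) :
    W⁻¹.trace = ∑ i, (μ i)⁻¹ := by
  rw [h.inv_eq_factor (h.eigval_pos hW), trace_mul_comm,
    transpose_invFactor_mul_self h.1 (h.eigval_pos hW), trace_diagonal]

lemma IsEigendecomposition.inv_eigval_le (h : IsEigendecomposition W μ u) (hW : W.PosDef)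
    (i : Fin d) : (μ i)⁻¹ ≤ W⁻¹.trace := by
  rw [h.trace_inv hW]
  exact Finset.single_le_sum (f := fun i => (μ i)⁻¹)
    (fun j _ => inv_nonneg.mpr (h.eigval_pos hW j).le) (Finset.mem_univ i)

lemma IsEigendecomposition.inv_add_eq (h : IsEigendecomposition W μ u) (hW : W.PosDef)
    (η l : ℝ) (x : Draw d) :
    W⁻¹ + η • lossEstimate W (playedVector μ u x) l x
      = invFactor μ u * (1 + η • whiteEstimate l x) * (invFactor μ u)ᵀ := by
  rw [h.lossEstimate_eq (h.eigval_pos hW), h.inv_eq_factor (h.eigval_pos hW)]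
  simp [mul_add, add_mul]

lemma IsEigendecomposition.posDef_inv_add (h : IsEigendecomposition W μ u) (hW : W.PosDef)
    (hd : 2 ≤ d) {η l : ℝ} (hη : 0 < η) (hηd : η * d ≤ 1 / 2) (hl : |l| ≤ 1) (x : Draw d) :
    (W⁻¹ + η • lossEstimate W (playedVector μ u x) l x).PosDef := by
  rw [h.inv_add_eq hW]
  refine (posDef_one_add_smul_whiteEstimate hd hη hηd hl x).mul_mul_conjTranspose_same ?_
  apply Matrix.vecMul_injective_of_isUnit
  refine IsUnit.of_mul_eq_one ((invFactor μ u)ᵀ * W) ?_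
  exact mul_eq_one_comm.mp (h.transpose_invFactor_mul hW)

/-- Congruence by R multiplies the determinant by det W⁻¹, which cancels log det W, and turns the
trace into d + η tr X; what remains is the white stability term. -/
lemma IsEigendecomposition.stability_le (h : IsEigendecomposition W μ u) (hW : W.PosDef)
    (hd : 2 ≤ d) {η l : ℝ} (hη : 0 < η) (hηd : η * d ≤ 1 / 2) (hl : |l| ≤ 1) (x : Draw d) :
    (W * (W⁻¹ + η • lossEstimate W (playedVector μ u x) l x)).trace - Real.log W.det
        - Real.log (W⁻¹ + η • lossEstimate W (playedVector μ u x) l x).det - d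
      ≤ 2 * η ^ 2 * d ^ 2 := by
  have hX := posDef_one_add_smul_whiteEstimate hd hη hηd hl x
  have hdet : (W⁻¹ + η • lossEstimate W (playedVector μ u x) l x).det
      = W⁻¹.det * (1 + η • whiteEstimate l x).det := by
    rw [h.inv_add_eq hW, h.inv_eq_factor (h.eigval_pos hW)]
    simp only [det_mul]; ring
  have htr : (W * (W⁻¹ + η • lossEstimate W (playedVector μ u x) l x)).trace
      = d + η * (whiteEstimate l x).trace := by
    rw [h.inv_add_eq hW, ← Matrix.mul_assoc, trace_mul_comm, ← Matrix.mul_assoc,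
      ← Matrix.mul_assoc, h.transpose_invFactor_mul hW, Matrix.one_mul]
    simp [trace_add, trace_smul]
  rw [hdet, htr, Real.log_mul hW.inv.det_pos.ne' hX.det_pos.ne', log_det_inv]
  have := trace_sub_log_det_whiteEstimate_le hd hη hηd hl x
  linarith

/-- Since RᵀR = Λ⁻¹, the trace is the sum of Xᵢᵢ/μᵢ. A sign draw has zero diagonal, and an
eigenvector draw has the single entry 2ℓ. This feeds the recursive bound on tr W⁻¹. -/
lemma IsEigendecomposition.trace_lossEstimate_le (h : IsEigendecomposition W μ u)
    (hW : W.PosDef) {l : ℝ} (hl : |l| ≤ 1) (x : Draw d) :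
    (lossEstimate W (playedVector μ u x) l x).trace ≤ 2 * W⁻¹.trace := by
  have hμ := h.eigval_pos hW
  have htr : (lossEstimate W (playedVector μ u x) l x).trace
      = (whiteEstimate l x * diagonal fun i => (μ i)⁻¹).trace := by
    rw [h.lossEstimate_eq hμ, trace_mul_comm, ← Matrix.mul_assoc, trace_mul_comm,
      transpose_invFactor_mul_self h.1 hμ]
  rw [htr]
  cases x with
  | diag i =>
    have h1 := h.inv_eigval_le hW i
    have h2 : (whiteEstimate l (.diag i) * diagonal fun i => (μ i)⁻¹).trace
        = 2 * l * (μ i)⁻¹ := by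
      simp [whiteEstimate, trace, mul_diagonal, vecMulVec_apply, Pi.single_apply]
    rw [h2]
    have := (abs_le.mp hl).2
    have := inv_pos.mpr (hμ i)
    nlinarith
  | signs s =>
    have h2 : (whiteEstimate l (.signs s) * diagonal fun i => (μ i)⁻¹).trace = 0 := by
      simp [whiteEstimate, trace, mul_diagonal, vecMulVec_apply, sign_mul_self]
    rw [h2, h.trace_inv hW]
    have := Finset.sum_nonneg fun i (_ : i ∈ Finset.univ) => (inv_pos.mpr (hμ i)).le
    linarith

end Eigendecomposition

/-! ### Sign moments and unbiasedness of the estimate -/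

/-- The two kinds of draws as a sum type. -/
def drawEquiv (d : ℕ) : Fin d ⊕ (Fin d → ℤˣ) ≃ Draw d where
  toFun := Sum.elim .diag .signs
  invFun
    | .diag i => .inl i
    | .signs s => .inr s
  left_inv x := by cases x <;> rfl
  right_inv x := by cases x <;> rfl

instance : Fintype (Draw d) := Fintype.ofEquiv _ (drawEquiv d)

lemma sum_draw {M : Type*} [AddCommMonoid M] (f : Draw d → M) :
    ∑ x, f x = ∑ i, f (.diag i) + ∑ s, f (.signs s) := by
  rw [← (drawEquiv d).sum_comp, Fintype.sum_sum_type]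
  rfl

lemma card_signs : Fintype.card (Fin d → ℤˣ) = 2 ^ d := by
  simp

/-- A function of the signs that is odd in one of them sums to zero. -/
lemma sum_signs_eq_zero (i : Fin d) {f : (Fin d → ℤˣ) → ℝ}
    (h : ∀ s, f (Function.update s i (-s i)) = -f s) : ∑ s, f s = 0 := by
  have hinv : Function.Involutive fun s : Fin d → ℤˣ => Function.update s i (-s i) := by
    intro s; simp
  have h1 : ∑ s, f (hinv.toPerm _ s) = ∑ s, f s := Equiv.sum_comp _ f
  have h2 : ∑ s, f (hinv.toPerm _ s) = -∑ s, f s := by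
    rw [← Finset.sum_neg_distrib]
    exact Finset.sum_congr rfl fun s _ => h s
  linarith

/-- A sign, as a real number. -/
abbrev sgn (s : Fin d → ℤˣ) (i : Fin d) : ℝ := ((s i : ℤ) : ℝ)

lemma sgn_update (s : Fin d → ℤˣ) (i j : Fin d) :
    sgn (Function.update s i (-s i)) j = if j = i then -sgn s j else sgn s j := by
  by_cases h : j = i
  · subst h; simp [sgn]
  · simp [sgn, h]

lemma sum_sgn_mul_sgn (a b : Fin d) :
    ∑ s : Fin d → ℤˣ, sgn s a * sgn s b = if a = b then 2 ^ d else 0 := by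
  split_ifs with h
  · subst h
    simp [sgn, sign_mul_self]
  · refine sum_signs_eq_zero a fun s => ?_
    simp [sgn_update, Ne.symm h]

/-- Unless a, b are i, j in some order, some index occurs an odd number of times; flipping its sign
negates the summand. -/
lemma sum_sgn_four {i j : Fin d} (hij : i ≠ j) (a b : Fin d) :
    ∑ s : Fin d → ℤˣ, sgn s a * sgn s b * (sgn s i * sgn s j)
      = 2 ^ d * ((if a = i ∧ b = j then 1 else 0) + if a = j ∧ b = i then 1 else 0) := by
  by_cases h1 : a = i ∧ b = j
  · obtain ⟨rfl, rfl⟩ := h1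
    have : ∀ s : Fin d → ℤˣ, sgn s a * sgn s b * (sgn s a * sgn s b) = 1 := fun s => by
      linear_combination (sgn s b * sgn s b) * sign_mul_self (s a) + sign_mul_self (s b)
    simp [this, hij]
  by_cases h2 : a = j ∧ b = i
  · obtain ⟨rfl, rfl⟩ := h2
    have : ∀ s : Fin d → ℤˣ, sgn s a * sgn s b * (sgn s b * sgn s a) = 1 := fun s => by
      linear_combination (sgn s b * sgn s b) * sign_mul_self (s a) + sign_mul_self (s b)
    simp [this, hij]
  rw [if_neg h1, if_neg h2, add_zero, mul_zero]
  by_cases hai : a = i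
  · subst hai
    by_cases hba : b = a
    · subst hba
      refine sum_signs_eq_zero b fun s => ?_
      simp [sgn_update, hij.symm]
    · have hbj : b ≠ j := fun h => h1 ⟨rfl, h⟩
      refine sum_signs_eq_zero j fun s => ?_
      simp [sgn_update, hij, hbj]
  · by_cases hbi : b = i
    · subst hbi
      have haj : a ≠ j := fun h => h2 ⟨h, rfl⟩
      refine sum_signs_eq_zero j fun s => ?_
      simp [sgn_update, hij, haj]
    · refine sum_signs_eq_zero i fun s => ?_
      simp [sgn_update, hij.symm, hai, hbi]

lemma coordLoss_diag (μ : Fin d → ℝ) (K : Matrix (Fin d) (Fin d) ℝ) (i : Fin d) :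
    coordLoss μ K (.diag i) = K i i := by
  simp [coordLoss, playedCoord]

lemma coordLoss_signs (μ : Fin d → ℝ) (K : Matrix (Fin d) (Fin d) ℝ) (s : Fin d → ℤˣ) :
    coordLoss μ K (.signs s)
      = ∑ a, ∑ b, Real.sqrt (μ a) * Real.sqrt (μ b) * K a b * (sgn s a * sgn s b) := by
  simp only [coordLoss, playedCoord, dotProduct, mulVec, Finset.mul_sum]
  refine Finset.sum_congr rfl fun a _ => Finset.sum_congr rfl fun b _ => ?_
  ring

lemma sum_coordLoss_signs_mul {μ : Fin d → ℝ} (K : Matrix (Fin d) (Fin d) ℝ)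
    (g : (Fin d → ℤˣ) → ℝ) :
    ∑ s, coordLoss μ K (.signs s) * g s
      = ∑ a, ∑ b, Real.sqrt (μ a) * Real.sqrt (μ b) * K a b *
          ∑ s, sgn s a * sgn s b * g s := by
  simp only [coordLoss_signs, Finset.sum_mul, Finset.mul_sum]
  rw [Finset.sum_comm]
  refine Finset.sum_congr rfl fun a _ => ?_
  rw [Finset.sum_comm]
  refine Finset.sum_congr rfl fun b _ => Finset.sum_congr rfl fun s _ => ?_
  ring

lemma half_pow_mul_two_pow : (1 / 2 : ℝ) ^ d * 2 ^ d = 1 := by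
  rw [← mul_pow]; norm_num

lemma sum_drawProb {μ : Fin d → ℝ} (hsum : ∑ i, μ i = 1) : ∑ x, drawProb μ x = 1 := by
  rw [sum_draw]
  simp only [drawProb, ← Finset.mul_sum, hsum, Finset.sum_const, Finset.card_univ, card_signs]
  simp only [nsmul_eq_mul, Nat.cast_pow, Nat.cast_ofNat]
  linear_combination (1 / 2 : ℝ) * half_pow_mul_two_pow (d := d)

/-- The played vector has second moment `W`. -/
lemma sum_drawProb_mul_coordLoss {μ : Fin d → ℝ} (hμ : ∀ i, 0 ≤ μ i)
    (K : Matrix (Fin d) (Fin d) ℝ) :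
    ∑ x, drawProb μ x * coordLoss μ K x = ∑ i, μ i * K i i := by
  have h := sum_coordLoss_signs_mul (μ := μ) K fun _ => 1
  simp only [mul_one, sum_sgn_mul_sgn, mul_ite, mul_zero, Finset.sum_ite_eq, Finset.mem_univ,
    if_true, Real.mul_self_sqrt (hμ _), ← Finset.sum_mul] at h
  rw [sum_draw]
  simp only [drawProb, coordLoss_diag, ← Finset.mul_sum, h, mul_assoc]
  linear_combination (1 / 2 : ℝ) * (∑ i, μ i * K i i) * half_pow_mul_two_pow (d := d)

/-- The whitened loss estimate has mean `Λ^{1/2} (K + Kᵀ) Λ^{1/2} / 2`. -/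
lemma sum_drawProb_smul_whiteEstimate {μ : Fin d → ℝ} (hμ : ∀ i, 0 ≤ μ i)
    (K : Matrix (Fin d) (Fin d) ℝ) :
    ∑ x, drawProb μ x • whiteEstimate (coordLoss μ K x) x
      = diagonal (fun i => Real.sqrt (μ i)) * ((1 / 2 : ℝ) • (K + Kᵀ)) *
          diagonal (fun i => Real.sqrt (μ i)) := by
  ext i j
  rw [Matrix.sum_apply, sum_draw]
  simp only [Matrix.smul_apply, drawProb, whiteEstimate, coordLoss_diag, smul_eq_mul,
    vecMulVec_apply, Matrix.sub_apply, mul_diagonal, diagonal_mul, Matrix.add_apply,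
    transpose_apply, Matrix.one_apply]
  -- Diagonal entries come from eigenvector draws alone, because ssᵀ - I has zero diagonal; the
  -- factor 2 in the estimate undoes the fair coin. Off the diagonal only sign draws count, and the
  -- fair coin itself gives the 1/2 in front of K + Kᵀ.
  by_cases hij : i = j
  · subst hij
    simp only [sign_mul_self, if_true, sub_self, mul_zero, Finset.sum_const_zero, add_zero]
    rw [Finset.sum_eq_single i (by intro b _ hb; simp [hb.symm]) (by simp)]
    simp only [Pi.single_eq_same]
    linear_combination -(K i i) * Real.mul_self_sqrt (hμ i)
  · have h0 : ∑ k, 1 / 2 * μ k * (2 * K k k *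
        ((Pi.single k 1 : Fin d → ℝ) i * (Pi.single k 1 : Fin d → ℝ) j)) = 0 := by
      refine Finset.sum_eq_zero fun k _ => ?_
      by_cases hk : i = k
      · subst hk; simp [Ne.symm hij]
      · simp [Pi.single_apply, hk]
    have h := sum_coordLoss_signs_mul (μ := μ) K fun s => sgn s i * sgn s j
    simp only [sum_sgn_four hij] at h
    have h1 : ∑ a, ∑ b, Real.sqrt (μ a) * Real.sqrt (μ b) * K a b * (2 ^ d *
        ((if a = i ∧ b = j then (1 : ℝ) else 0) + if a = j ∧ b = i then 1 else 0))
        = 2 ^ d * (Real.sqrt (μ i) * Real.sqrt (μ j) * (K i j + K j i)) := by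
      simp only [mul_add, Finset.sum_add_distrib, ite_and, mul_ite, mul_one, mul_zero,
        Finset.sum_ite_eq', Finset.sum_ite_irrel, Finset.sum_const_zero, Finset.mem_univ, if_true]
      ring
    rw [h1] at h
    rw [h0]
    simp only [hij, if_false, sub_zero, ← Finset.mul_sum, h, zero_add]
    linear_combination (1 / 2 : ℝ) * (Real.sqrt (μ i) * Real.sqrt (μ j) * (K i j + K j i)) *
      half_pow_mul_two_pow (d := d)

lemma invFactor_mul_diagonal_sqrt {μ : Fin d → ℝ} (hμ : ∀ i, 0 < μ i)
    (u : Fin d → EuclideanSpace ℝ (Fin d)) :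
    invFactor μ u * diagonal (fun i => Real.sqrt (μ i)) = colMatrix u := by
  rw [invFactor, Matrix.mul_assoc, diagonal_mul_diagonal]
  simp [fun i => inv_mul_cancel₀ (Real.sqrt_pos.mpr (hμ i)).ne']

/-- The loss estimate is unbiased, when tested against symmetric matrices. -/
lemma sum_drawProb_mul_frobInner {μ : Fin d → ℝ} {u : Fin d → EuclideanSpace ℝ (Fin d)}
    (hu : Orthonormal ℝ u) (hμ : ∀ i, 0 < μ i) {S : Matrix (Fin d) (Fin d) ℝ} (hS : Sᵀ = S)
    (A : Matrix (Fin d) (Fin d) ℝ) :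
    ∑ x, drawProb μ x * frobInner S (invFactor μ u *
        whiteEstimate (coordLoss μ ((colMatrix u)ᵀ * A * colMatrix u) x) x * (invFactor μ u)ᵀ)
      = frobInner S A := by
  set K := (colMatrix u)ᵀ * A * colMatrix u with hK
  have h1 : ∑ x, drawProb μ x * frobInner S (invFactor μ u *
        whiteEstimate (coordLoss μ K x) x * (invFactor μ u)ᵀ)
      = frobInner S (invFactor μ u * (∑ x, drawProb μ x • whiteEstimate (coordLoss μ K x) x) *
          (invFactor μ u)ᵀ) := by
    simp only [frobInner, Matrix.mul_sum, Matrix.sum_mul, trace_sum, mul_smul_comm,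
      smul_mul_assoc, trace_smul, smul_eq_mul]
  have hcc : ∀ B : Matrix (Fin d) (Fin d) ℝ, colMatrix u * ((colMatrix u)ᵀ * B * colMatrix u) *
      (colMatrix u)ᵀ = B := fun B => by
    calc _ = (colMatrix u * (colMatrix u)ᵀ) * B * (colMatrix u * (colMatrix u)ᵀ) := by
          simp only [Matrix.mul_assoc]
      _ = B := by rw [colMatrix_mul_transpose hu]; simp
  have hKT : Kᵀ = (colMatrix u)ᵀ * Aᵀ * colMatrix u := by
    rw [hK]; simp [transpose_mul, Matrix.mul_assoc]
  have h2 : invFactor μ u * (diagonal (fun i => Real.sqrt (μ i)) * ((1 / 2 : ℝ) • (K + Kᵀ)) *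
          diagonal (fun i => Real.sqrt (μ i))) * (invFactor μ u)ᵀ
      = (1 / 2 : ℝ) • (A + Aᵀ) := by
    have hT : diagonal (fun i => Real.sqrt (μ i)) * (invFactor μ u)ᵀ = (colMatrix u)ᵀ := by
      rw [← invFactor_mul_diagonal_sqrt hμ u, transpose_mul, diagonal_transpose]
    calc _ = (invFactor μ u * diagonal (fun i => Real.sqrt (μ i))) * ((1 / 2 : ℝ) • (K + Kᵀ)) *
          (diagonal (fun i => Real.sqrt (μ i)) * (invFactor μ u)ᵀ) := by
          simp only [Matrix.mul_assoc]
      _ = (1 / 2 : ℝ) • (colMatrix u * K * (colMatrix u)ᵀ +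
            colMatrix u * Kᵀ * (colMatrix u)ᵀ) := by
          rw [hT, invFactor_mul_diagonal_sqrt hμ]
          simp [mul_add, add_mul]
      _ = _ := by rw [hKT, hK, hcc, hcc]
  rw [h1, sum_drawProb_smul_whiteEstimate (fun i => (hμ i).le), h2]
  have h3 : (S * Aᵀ).trace = (S * A).trace := by
    rw [← trace_transpose, transpose_mul, transpose_transpose, hS, trace_mul_comm]
  simp only [frobInner, hS, mul_smul_comm, mul_add, trace_smul, trace_add, h3, smul_eq_mul]
  ring

lemma IsEigendecomposition.sum_eigval_mul {W : Matrix (Fin d) (Fin d) ℝ} {μ : Fin d → ℝ}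
    {u : Fin d → EuclideanSpace ℝ (Fin d)} (h : IsEigendecomposition W μ u)
    (A : Matrix (Fin d) (Fin d) ℝ) :
    ∑ i, μ i * ((colMatrix u)ᵀ * A * colMatrix u) i i = frobInner W A := by
  have : Wᵀ = W := by rw [h.eq_mul]; simp [transpose_mul, Matrix.mul_assoc]
  rw [frobInner, this]
  have : (W * A).trace = (diagonal μ * ((colMatrix u)ᵀ * A * colMatrix u)).trace := by
    rw [h.eq_mul, Matrix.mul_assoc, Matrix.mul_assoc, trace_mul_comm]
    simp only [Matrix.mul_assoc]
  rw [this]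
  simp [trace, diagonal_mul]

/-! ### Bounded measurable functions and norm bounds -/

/-- Measurable and bounded real functions. -/
def IsBddMeasurable {Ω : Type*} (m : MeasurableSpace Ω) (f : Ω → ℝ) : Prop :=
  Measurable[m] f ∧ ∃ C, ∀ ω, |f ω| ≤ C

namespace IsBddMeasurable

variable {Ω : Type*} {m : MeasurableSpace Ω} {f g : Ω → ℝ}

lemma const (c : ℝ) : IsBddMeasurable m fun _ => c := ⟨measurable_const, |c|, fun _ => le_rfl⟩

lemma add (hf : IsBddMeasurable m f) (hg : IsBddMeasurable m g) :
    IsBddMeasurable m fun ω => f ω + g ω := by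
  obtain ⟨hf, C, hC⟩ := hf
  obtain ⟨hg, D, hD⟩ := hg
  exact ⟨hf.add hg, C + D, fun ω => (abs_add_le _ _).trans (add_le_add (hC ω) (hD ω))⟩

lemma mul (hf : IsBddMeasurable m f) (hg : IsBddMeasurable m g) :
    IsBddMeasurable m fun ω => f ω * g ω := by
  obtain ⟨hf, C, hC⟩ := hf
  obtain ⟨hg, D, hD⟩ := hg
  refine ⟨hf.mul hg, C * D, fun ω => ?_⟩
  rw [abs_mul]
  exact mul_le_mul (hC ω) (hD ω) (abs_nonneg _) ((abs_nonneg _).trans (hC ω))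

lemma sub (hf : IsBddMeasurable m f) (hg : IsBddMeasurable m g) :
    IsBddMeasurable m fun ω => f ω - g ω := by
  simpa [sub_eq_add_neg] using hf.add ((const (-1)).mul hg)

lemma sum {ι : Type*} {s : Finset ι} {f : ι → Ω → ℝ} (hf : ∀ i, IsBddMeasurable m (f i)) :
    IsBddMeasurable m fun ω => ∑ i ∈ s, f i ω := by
  classical
  induction s using Finset.induction_on with
  | empty => simpa using const 0
  | insert a s ha ih => simpa [Finset.sum_insert ha] using (hf a).add ih

lemma matrix_mul {A B : Ω → Matrix (Fin d) (Fin d) ℝ}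
    (hA : ∀ i j, IsBddMeasurable m fun ω => A ω i j)
    (hB : ∀ i j, IsBddMeasurable m fun ω => B ω i j) (i j : Fin d) :
    IsBddMeasurable m fun ω => (A ω * B ω) i j := by
  simp only [mul_apply]
  exact sum fun k => (hA i k).mul (hB k j)

lemma diagonal {f : Ω → Fin d → ℝ} (hf : ∀ i, IsBddMeasurable m fun ω => f ω i) (i j : Fin d) :
    IsBddMeasurable m fun ω => Matrix.diagonal (f ω) i j := by
  by_cases h : i = j
  · subst h; simpa using hf i
  · simpa [h] using const 0

lemma frobInner {A B : Ω → Matrix (Fin d) (Fin d) ℝ}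
    (hA : ∀ i j, IsBddMeasurable m fun ω => A ω i j)
    (hB : ∀ i j, IsBddMeasurable m fun ω => B ω i j) :
    IsBddMeasurable m fun ω => frobInner (A ω) (B ω) := by
  simp only [BanditPCA.frobInner, trace, diag_apply]
  exact sum fun k => matrix_mul (fun i j => hA j i) hB k k

end IsBddMeasurable

lemma isBddMeasurable_whiteEstimate {Ω : Type*} {m : MeasurableSpace Ω} {l : Ω → ℝ}
    (hl : IsBddMeasurable m l) (x : Draw d) (i j : Fin d) :
    IsBddMeasurable m fun ω => whiteEstimate (l ω) x i j := by
  cases x with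
  | diag k =>
    simp only [whiteEstimate, Matrix.smul_apply, smul_eq_mul]
    exact ((IsBddMeasurable.const 2).mul hl).mul (IsBddMeasurable.const _)
  | signs s =>
    simp only [whiteEstimate, Matrix.smul_apply, smul_eq_mul]
    exact hl.mul (IsBddMeasurable.const _)

lemma abs_matrix_apply_le (A : Matrix (Fin d) (Fin d) ℝ) (i j : Fin d) :
    |A i j| ≤ matrixSpectralNorm A := by
  have h : inner ℝ (EuclideanSpace.single i (1 : ℝ))
      (Matrix.toEuclideanCLM (n := Fin d) (𝕜 := ℝ) A (EuclideanSpace.single j 1)) = A i j := by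
    rw [Matrix.inner_toEuclideanCLM]; simp
  rw [← h]
  refine (abs_real_inner_le_norm _ _).trans ?_
  have := (Matrix.toEuclideanCLM (n := Fin d) (𝕜 := ℝ) A).le_opNorm (EuclideanSpace.single j 1)
  simpa [matrixSpectralNorm] using this

lemma mixedEigenvalues_zero (μ : Fin d → ℝ) : mixedEigenvalues 0 μ = μ := by
  ext i; simp [mixedEigenvalues]

lemma mixedMatrix_zero (W : Matrix (Fin d) (Fin d) ℝ) : mixedMatrix 0 W = W := by
  simp [mixedMatrix]

lemma abs_frobInner_sub_le {v w : EuclideanSpace ℝ (Fin d)} (hv : ‖v‖ = 1) (hw : ‖w‖ = 1)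
    {A : Matrix (Fin d) (Fin d) ℝ} (hA : matrixSpectralNorm A ≤ 1) :
    |frobInner (outer v - outer w) A| ≤ 2 := by
  have h1 := abs_frobInner_outer_le v A
  have h2 := abs_frobInner_outer_le w A
  rw [hv] at h1
  rw [hw] at h2
  have h3 : frobInner (outer v - outer w) A = frobInner (outer v) A - frobInner (outer w) A := by
    simp [frobInner, sub_mul]
  rw [h3]
  refine (abs_sub _ _).trans ?_
  linarith

/-! ### The pathwise regret bound -/

namespace Interaction

variable {T : ℕ} {η : ℝ} {Ω : Type*} [mΩ : MeasurableSpace Ω] {P : Measure Ω}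

lemma posDef_and_trace (hd : 1 ≤ d) (X : Interaction d T η 0 P) {t : ℕ} (ht : t ≤ T) (ω : Ω) :
    (X.W t ω).PosDef ∧ (X.W t ω).trace = 1 := by
  cases t with
  | zero =>
    have hd' : (0 : ℝ) < d := by exact_mod_cast hd
    rw [X.init]
    refine ⟨PosDef.one.smul (by positivity), ?_⟩
    simp [trace_smul, hd'.ne']
  | succ t => exact ⟨(X.update t ht ω).1, (X.update t ht ω).2.1⟩

lemma eigval_pos (hd : 1 ≤ d) (X : Interaction d T η 0 P) {t : ℕ} (ht : t < T) (ω : Ω)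
    (i : Fin d) : 0 < X.eigval t ω i :=
  (X.eigendecomposition t ht ω).eigval_pos (X.posDef_and_trace hd ht.le ω).1 i

lemma sum_eigval (hd : 1 ≤ d) (X : Interaction d T η 0 P) {t : ℕ} (ht : t < T) (ω : Ω) :
    ∑ i, X.eigval t ω i = 1 := by
  rw [← (X.eigendecomposition t ht ω).trace_eq, (X.posDef_and_trace hd ht.le ω).2]

lemma played_eq (X : Interaction d T η 0 P) (t : ℕ) (ω : Ω) :
    X.played t ω = playedVector (X.eigval t ω) (X.eigvec t ω) (X.draw t ω) := by
  rw [played, mixedEigenvalues_zero]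

lemma norm_played (hd : 1 ≤ d) (X : Interaction d T η 0 P) {t : ℕ} (ht : t < T) (ω : Ω) :
    ‖X.played t ω‖ = 1 := by
  rw [played_eq]
  exact norm_playedVector (X.eigendecomposition t ht ω).1 (fun i => (X.eigval_pos hd ht ω i).le)
    (X.sum_eigval hd ht ω) _

lemma abs_loss_le (hd : 1 ≤ d) (X : Interaction d T η 0 P) {t : ℕ} (ht : t < T) (ω : Ω) :
    |frobInner (outer (X.played t ω)) (X.L t ω)| ≤ 1 := by
  have := abs_frobInner_outer_le (X.played t ω) (X.L t ω)
  rw [X.norm_played hd ht] at this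
  linarith [X.loss_le_one t ht ω]

/-- The loss estimate of round `t`. -/
def estimate (X : Interaction d T η 0 P) (t : ℕ) (ω : Ω) : Matrix (Fin d) (Fin d) ℝ :=
  lossEstimate (X.W t ω) (X.played t ω) (frobInner (outer (X.played t ω)) (X.L t ω)) (X.draw t ω)

lemma isUpdate (X : Interaction d T η 0 P) {t : ℕ} (ht : t < T) (ω : Ω) :
    IsUpdate η (X.W t ω) (X.estimate t ω) (X.W (t + 1) ω) := by
  have := X.update t ht ω
  rwa [mixedMatrix_zero] at this

lemma posDef_inv_add (hd : 2 ≤ d) (hη : 0 < η) (hηd : η * d ≤ 1 / 2)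
    (X : Interaction d T η 0 P) {t : ℕ} (ht : t < T) (ω : Ω) :
    ((X.W t ω)⁻¹ + η • X.estimate t ω).PosDef := by
  have hd1 : 1 ≤ d := by omega
  have hl := X.abs_loss_le hd1 ht ω
  unfold estimate
  rw [played_eq] at hl ⊢
  exact (X.eigendecomposition t ht ω).posDef_inv_add (X.posDef_and_trace hd1 ht.le ω).1 hd hη
    hηd hl _

/-- The inverses of the density matrices are bounded uniformly on the probability space. -/
lemma exists_trace_inv_le (hd : 2 ≤ d) (hη : 0 < η) (hηd : η * d ≤ 1 / 2)
    (X : Interaction d T η 0 P) {t : ℕ} (ht : t ≤ T) :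
    ∃ C : ℝ, ∀ ω, (X.W t ω)⁻¹.trace ≤ C := by
  have hd1 : 1 ≤ d := by omega
  induction t with
  | zero => exact ⟨((1 / d : ℝ) • (1 : Matrix (Fin d) (Fin d) ℝ))⁻¹.trace, fun ω => by rw [X.init]⟩
  | succ t ih =>
    obtain ⟨C, hC⟩ := ih (by omega)
    refine ⟨C + η * (2 * C) + d * d, fun ω => ?_⟩
    have h1 := (X.isUpdate ht ω).trace_inv_le (X.posDef_inv_add hd hη hηd ht ω)
    have hl := X.abs_loss_le hd1 ht ω
    have h2 : (X.estimate t ω).trace ≤ 2 * (X.W t ω)⁻¹.trace := by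
      unfold estimate
      rw [played_eq] at hl ⊢
      exact (X.eigendecomposition t ht ω).trace_lossEstimate_le
        (X.posDef_and_trace hd1 (Nat.le_of_succ_le ht) ω).1 hl _
    have h3 := mul_le_mul_of_nonneg_left (h2.trans (mul_le_mul_of_nonneg_left (hC ω) zero_le_two))
      hη.le
    linarith [hC ω]

lemma step_le (hd : 2 ≤ d) (hη : 0 < η) (hηd : η * d ≤ 1 / 2)
    (X : Interaction d T η 0 P) {t : ℕ} (ht : t < T) (ω : Ω) {U : Matrix (Fin d) (Fin d) ℝ}
    (hU : U.trace = 1) :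
    η * ((X.W t ω - U) * X.estimate t ω).trace
      ≤ logDetDiv U (X.W t ω) - logDetDiv U (X.W (t + 1) ω) + 2 * η ^ 2 * d ^ 2 := by
  have hd1 : 1 ≤ d := by omega
  have hW := (X.posDef_and_trace hd1 ht.le ω).1
  refine ((X.isUpdate ht ω).mul_trace_le hW hU (X.posDef_inv_add hd hη hηd ht ω)).trans ?_
  have hl := X.abs_loss_le hd1 ht ω
  refine add_le_add_right ?_ _
  unfold estimate
  rw [played_eq] at hl ⊢
  exact (X.eigendecomposition t ht ω).stability_le hW hd hη hηd hl _

/-- The pathwise regret bound of mirror descent on the estimated losses. -/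
lemma sum_trace_le (hd : 2 ≤ d) (hη : 0 < η) (hηd : η * d ≤ 1 / 2)
    (X : Interaction d T η 0 P) (ω : Ω) {U : Matrix (Fin d) (Fin d) ℝ}
    (hU : U.PosDef) (htU : U.trace = 1) :
    η * ∑ t ∈ Finset.range T, ((X.W t ω - U) * X.estimate t ω).trace
      ≤ logDetDiv U (X.W 0 ω) + T * (2 * η ^ 2 * d ^ 2) := by
  have h1 : ∑ t ∈ Finset.range T, η * ((X.W t ω - U) * X.estimate t ω).trace
      ≤ ∑ t ∈ Finset.range T, (logDetDiv U (X.W t ω) - logDetDiv U (X.W (t + 1) ω)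
          + 2 * η ^ 2 * d ^ 2) :=
    Finset.sum_le_sum fun t ht => X.step_le hd hη hηd (Finset.mem_range.mp ht) ω htU
  rw [Finset.sum_add_distrib, Finset.sum_range_sub' (fun t => logDetDiv U (X.W t ω))] at h1
  have h2 := logDetDiv_nonneg hU (X.posDef_and_trace (by omega) le_rfl ω).1
  rw [Finset.mul_sum]
  simp only [Finset.sum_const, Finset.card_range, nsmul_eq_mul] at h1
  linarith

/-! ### Averaging over the coins given the past -/

section Probability

variable [IsProbabilityMeasure P]

/-- A bounded factor known before the coins are tossed can be pulled out of the conditional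
expectation, which replaces the indicator by the conditional probability. -/
lemma integral_draw_mul (X : Interaction d T η 0 P) {t : ℕ} (ht : t < T) {g : Ω → ℝ}
    (hg : IsBddMeasurable (X.ℱ t) g) (x : Draw d) :
    Integrable (fun ω => (X.draw t ⁻¹' {x}).indicator (fun _ => (1 : ℝ)) ω * g ω) P ∧
    Integrable (fun ω => drawProb (X.eigval t ω) x * g ω) P ∧
    ∫ ω, (X.draw t ⁻¹' {x}).indicator (fun _ => (1 : ℝ)) ω * g ω ∂P
      = ∫ ω, drawProb (X.eigval t ω) x * g ω ∂P := by
  have hms : MeasurableSet (X.draw t ⁻¹' {x}) := X.ℱ.le _ _ (X.measurable_draw t ht x)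
  have h1 : Integrable ((X.draw t ⁻¹' {x}).indicator (fun _ => (1 : ℝ))) P :=
    (integrable_const 1).indicator hms
  have h2 : Integrable (fun ω => (X.draw t ⁻¹' {x}).indicator (fun _ => (1 : ℝ)) ω * g ω) P := by
    obtain ⟨hgm, C, hC⟩ := hg
    exact h1.mul_bdd (c := C) (hgm.mono (X.ℱ.le t) le_rfl).aestronglyMeasurable
      (Filter.Eventually.of_forall hC)
  have h3 : P[fun ω => (X.draw t ⁻¹' {x}).indicator (fun _ => (1 : ℝ)) ω * g ω | X.ℱ t] =ᵐ[P]
      fun ω => drawProb (X.eigval t ω) x * g ω := by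
    have := condExp_mul_of_stronglyMeasurable_right hg.1.stronglyMeasurable h2 h1
    refine this.trans ?_
    filter_upwards [X.law_draw t ht x] with ω hω
    rw [Pi.mul_apply, hω, mixedEigenvalues_zero]
  refine ⟨h2, integrable_condExp.congr h3, ?_⟩
  rw [← integral_condExp (X.ℱ.le t)]
  exact integral_congr_ae h3

/-- There are finitely many draws, so a function of the draw is a finite sum of indicators times
functions of the past. -/
lemma integral_draw (X : Interaction d T η 0 P) {t : ℕ} (ht : t < T) {g : Draw d → Ω → ℝ}
    (hg : ∀ x, IsBddMeasurable (X.ℱ t) (g x)) :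
    Integrable (fun ω => g (X.draw t ω) ω) P ∧
    Integrable (fun ω => ∑ x, drawProb (X.eigval t ω) x * g x ω) P ∧
    ∫ ω, g (X.draw t ω) ω ∂P = ∫ ω, ∑ x, drawProb (X.eigval t ω) x * g x ω ∂P := by
  have h := fun x => X.integral_draw_mul ht (hg x) x
  have h1 : (fun ω => g (X.draw t ω) ω)
      = fun ω => ∑ x, (X.draw t ⁻¹' {x}).indicator (fun _ => (1 : ℝ)) ω * g x ω := by
    ext ω
    rw [Finset.sum_eq_single (X.draw t ω)]
    · simp
    · intro x _ hx
      simp [Set.indicator, hx.symm]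
    · simp
  rw [h1]
  refine ⟨integrable_finsetSum _ fun x _ => (h x).1,
    integrable_finsetSum _ fun x _ => (h x).2.1, ?_⟩
  rw [integral_finsetSum _ fun x _ => (h x).1, integral_finsetSum _ fun x _ => (h x).2.1]
  exact Finset.sum_congr rfl fun x _ => (h x).2.2

end Probability

/-! ### Measurability and boundedness of the quantities of one round -/

section Bounded

variable (X : Interaction d T η 0 P) {t : ℕ}

lemma isBddMeasurable_loss (ht : t < T) (i j : Fin d) :
    IsBddMeasurable (X.ℱ t) fun ω => X.L t ω i j :=
  ⟨X.measurable_loss t ht i j, 1, fun ω => (abs_matrix_apply_le _ _ _).trans (X.loss_le_one t ht ω)⟩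

lemma measurable_eigval_apply (ht : t < T) (i : Fin d) :
    Measurable[X.ℱ t] fun ω => X.eigval t ω i :=
  (measurable_pi_apply i).comp (X.measurable_eigval t ht)

lemma eigval_le_one (hd : 1 ≤ d) (ht : t < T) (ω : Ω) (i : Fin d) : X.eigval t ω i ≤ 1 := by
  rw [← X.sum_eigval hd ht ω]
  exact Finset.single_le_sum (fun j _ => (X.eigval_pos hd ht ω j).le) (Finset.mem_univ i)

lemma isBddMeasurable_eigval (hd : 1 ≤ d) (ht : t < T) (i : Fin d) :
    IsBddMeasurable (X.ℱ t) fun ω => X.eigval t ω i :=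
  ⟨X.measurable_eigval_apply ht i, 1, fun ω => by
    rw [abs_of_pos (X.eigval_pos hd ht ω i)]; exact X.eigval_le_one hd ht ω i⟩

lemma isBddMeasurable_sqrt_eigval (hd : 1 ≤ d) (ht : t < T) (i : Fin d) :
    IsBddMeasurable (X.ℱ t) fun ω => Real.sqrt (X.eigval t ω i) :=
  ⟨(X.measurable_eigval_apply ht i).sqrt, 1, fun ω => by
    rw [abs_of_nonneg (Real.sqrt_nonneg _)]
    exact Real.sqrt_le_one.mpr (X.eigval_le_one hd ht ω i)⟩

/-- Eigenvalues are at most 1, so λ^{-1/2} ≤ λ⁻¹ ≤ tr W⁻¹, and the last is bounded uniformly in ω.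
-/
lemma isBddMeasurable_inv_sqrt_eigval (hd : 2 ≤ d) (hη : 0 < η) (hηd : η * d ≤ 1 / 2)
    (ht : t < T) (i : Fin d) :
    IsBddMeasurable (X.ℱ t) fun ω => (Real.sqrt (X.eigval t ω i))⁻¹ := by
  have hd1 : 1 ≤ d := by omega
  obtain ⟨C, hC⟩ := X.exists_trace_inv_le hd hη hηd ht.le
  refine ⟨(X.measurable_eigval_apply ht i).sqrt.inv, C, fun ω => ?_⟩
  have hpos := X.eigval_pos hd1 ht ω i
  rw [abs_of_nonneg (inv_nonneg.mpr (Real.sqrt_nonneg _))]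
  calc _ ≤ (X.eigval t ω i)⁻¹ := by
        refine inv_anti₀ hpos ?_
        apply Real.le_sqrt_of_sq_le
        nlinarith [X.eigval_le_one hd1 ht ω i]
    _ ≤ _ := (X.eigendecomposition t ht ω).inv_eigval_le (X.posDef_and_trace hd1 ht.le ω).1 i
    _ ≤ C := hC ω

lemma isBddMeasurable_colMatrix (ht : t < T) (i j : Fin d) :
    IsBddMeasurable (X.ℱ t) fun ω => colMatrix (X.eigvec t ω) i j := by
  refine ⟨?_, 1, fun ω => ?_⟩
  · have h1 : Measurable[X.ℱ t] fun ω => X.eigvec t ω j :=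
      (measurable_pi_apply j).comp (X.measurable_eigvec t ht)
    exact (EuclideanSpace.proj i : EuclideanSpace ℝ (Fin d) →L[ℝ] ℝ).continuous.measurable.comp h1
  · rw [← (X.eigendecomposition t ht ω).1.1 j]
    exact PiLp.norm_apply_le (X.eigvec t ω j) i

/-- Measurability is assumed only of the eigendecomposition; that of W is recovered by reassembling
it. -/
lemma isBddMeasurable_density (hd : 1 ≤ d) (ht : t < T) (i j : Fin d) :
    IsBddMeasurable (X.ℱ t) fun ω => X.W t ω i j := by
  have h : (fun ω => X.W t ω i j) = fun ω => (colMatrix (X.eigvec t ω) *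
      diagonal (X.eigval t ω) * (colMatrix (X.eigvec t ω))ᵀ) i j := by
    ext ω; rw [← (X.eigendecomposition t ht ω).eq_mul]
  rw [h]
  exact IsBddMeasurable.matrix_mul (IsBddMeasurable.matrix_mul (X.isBddMeasurable_colMatrix ht)
    (IsBddMeasurable.diagonal (X.isBddMeasurable_eigval hd ht)))
    (fun i j => X.isBddMeasurable_colMatrix ht j i) i j

lemma isBddMeasurable_invFactor (hd : 2 ≤ d) (hη : 0 < η) (hηd : η * d ≤ 1 / 2) (ht : t < T)
    (i j : Fin d) :
    IsBddMeasurable (X.ℱ t) fun ω => invFactor (X.eigval t ω) (X.eigvec t ω) i j :=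
  IsBddMeasurable.matrix_mul (X.isBddMeasurable_colMatrix ht)
    (IsBddMeasurable.diagonal (X.isBddMeasurable_inv_sqrt_eigval hd hη hηd ht)) i j

lemma isBddMeasurable_coordLoss (hd : 1 ≤ d) (ht : t < T) (x : Draw d) :
    IsBddMeasurable (X.ℱ t) fun ω => coordLoss (X.eigval t ω)
      ((colMatrix (X.eigvec t ω))ᵀ * X.L t ω * colMatrix (X.eigvec t ω)) x := by
  have hK := IsBddMeasurable.matrix_mul (IsBddMeasurable.matrix_mul
    (fun i j => X.isBddMeasurable_colMatrix ht j i) (X.isBddMeasurable_loss ht))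
    (X.isBddMeasurable_colMatrix ht)
  cases x with
  | diag i => simp only [coordLoss_diag]; exact hK i i
  | signs s =>
    simp only [coordLoss_signs]
    exact IsBddMeasurable.sum fun a => IsBddMeasurable.sum fun b =>
      (((X.isBddMeasurable_sqrt_eigval hd ht a).mul (X.isBddMeasurable_sqrt_eigval hd ht b)).mul
        (hK a b)).mul (IsBddMeasurable.const _)

end Bounded

end Interaction

/-! ### The smoothed comparator -/

/-- The rank one density `u uᵀ`, mixed with a bit of the maximally mixed density. -/
def smoothedOuter (ε : ℝ) (u : EuclideanSpace ℝ (Fin d)) : Matrix (Fin d) (Fin d) ℝ :=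
  (ε / d) • (1 : Matrix (Fin d) (Fin d) ℝ) + (1 - ε) • outer u

lemma dotProduct_self_of_norm {u : EuclideanSpace ℝ (Fin d)} (hu : ‖u‖ = 1) :
    u.ofLp ⬝ᵥ u.ofLp = 1 := by
  have := EuclideanSpace.real_norm_sq_eq u
  rw [hu] at this
  simp only [dotProduct, ← sq]
  linarith

lemma transpose_smoothedOuter (ε : ℝ) (u : EuclideanSpace ℝ (Fin d)) :
    (smoothedOuter ε u)ᵀ = smoothedOuter ε u := by
  simp [smoothedOuter, outer, transpose_vecMulVec]

lemma trace_smoothedOuter (hd : 1 ≤ d) (ε : ℝ) {u : EuclideanSpace ℝ (Fin d)} (hu : ‖u‖ = 1) :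
    (smoothedOuter ε u).trace = 1 := by
  have hd' : (d : ℝ) ≠ 0 := by positivity
  simp only [smoothedOuter, outer, trace_add, trace_smul, trace_one, trace_vecMulVec,
    dotProduct_self_of_norm hu, Fintype.card_fin, smul_eq_mul]
  field_simp; ring

lemma posDef_smoothedOuter (hd : 1 ≤ d) {ε : ℝ} (hε : 0 < ε) (hε1 : ε ≤ 1)
    {u : EuclideanSpace ℝ (Fin d)} (hu : ‖u‖ = 1) : (smoothedOuter ε u).PosDef := by
  have hd' : (0 : ℝ) < d := by exact_mod_cast hd
  have : 0 < ε / d := by positivity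
  apply posDef_smul_one_add_smul_vecMulVec this
  rw [dotProduct_self_of_norm hu]; linarith

/-- The trace term equals d and cancels, det U ≥ (ε/d)^d, and the resulting d log d cancels against
log det(I/d). -/
lemma logDetDiv_smoothedOuter_le (hd : 1 ≤ d) {ε : ℝ} (hε : 0 < ε) (hε1 : ε ≤ 1)
    {u : EuclideanSpace ℝ (Fin d)} (hu : ‖u‖ = 1) :
    logDetDiv (smoothedOuter ε u) ((1 / d : ℝ) • (1 : Matrix (Fin d) (Fin d) ℝ))
      ≤ d * -Real.log ε := by
  have hd' : (0 : ℝ) < d := by exact_mod_cast hd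
  have ha : 0 < ε / d := by positivity
  have hinv : ((1 / d : ℝ) • (1 : Matrix (Fin d) (Fin d) ℝ))⁻¹
      = (d : ℝ) • (1 : Matrix (Fin d) (Fin d) ℝ) := by
    apply Matrix.inv_eq_right_inv
    rw [smul_mul_smul_comm, one_div, inv_mul_cancel₀ hd'.ne', Matrix.one_mul, one_smul]
  have hc : 1 ≤ 1 + (1 - ε) / (ε / d) * (u.ofLp ⬝ᵥ u.ofLp) := by
    rw [dotProduct_self_of_norm hu, mul_one]
    have : 0 ≤ (1 - ε) / (ε / d) := div_nonneg (by linarith) ha.le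
    linarith
  have hdet : d * (Real.log ε - Real.log d) ≤ Real.log (smoothedOuter ε u).det := by
    rw [smoothedOuter, outer, det_smul_one_add_smul_vecMulVec _ _ ha.ne',
      Real.log_mul (by positivity) (by linarith), Real.log_pow, Real.log_div hε.ne' hd'.ne']
    linarith [Real.log_nonneg hc]
  unfold logDetDiv
  rw [hinv, mul_smul_comm, Matrix.mul_one, trace_smul, trace_smoothedOuter hd ε hu, det_smul,
    det_one, mul_one, Real.log_pow, one_div, Real.log_inv, Fintype.card_fin, smul_eq_mul]
  linarith

lemma frobInner_smoothedOuter_sub_le (hd : 1 ≤ d) {ε : ℝ} (hε : 0 ≤ ε)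
    {u : EuclideanSpace ℝ (Fin d)} (hu : ‖u‖ = 1) {A : Matrix (Fin d) (Fin d) ℝ}
    (hA : matrixSpectralNorm A ≤ 1) :
    frobInner (smoothedOuter ε u - outer u) A ≤ 2 * ε := by
  have hd' : (0 : ℝ) < d := by exact_mod_cast hd
  have h1 : frobInner (smoothedOuter ε u - outer u) A
      = ε * (A.trace / d - frobInner (outer u) A) := by
    simp only [frobInner, smoothedOuter, transpose_sub, transpose_add, transpose_smul,
      transpose_one, sub_mul, add_mul, smul_mul_assoc, Matrix.one_mul, trace_sub, trace_add,
      trace_smul, smul_eq_mul]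
    ring
  have h2 := abs_frobInner_outer_le u A
  rw [hu] at h2
  have h3 : A.trace ≤ d := by
    calc A.trace ≤ ∑ _i : Fin d, (1 : ℝ) := Finset.sum_le_sum fun i _ =>
          (le_abs_self _).trans ((abs_matrix_apply_le A i i).trans hA)
      _ = d := by simp
  have h4 : A.trace / d ≤ 1 := (div_le_one hd').mpr h3
  rw [h1]
  have h5 := (abs_le.mp h2).1
  nlinarith

/-! ### Expected regret and tuning of the learning rate -/

namespace Interaction

variable {T : ℕ} {η : ℝ} {Ω : Type*} [mΩ : MeasurableSpace Ω] {P : Measure Ω}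

/-- In dimension one every unit vector has vvᵀ = 1. The case is separate because ηd ≤ 1/2 then does
not keep 1 + 2ηℓ positive. -/
lemma regretAgainst_eq_zero (hd : d = 1) (X : Interaction d T η 0 P)
    {u : EuclideanSpace ℝ (Fin d)} (hu : ‖u‖ = 1) : X.regretAgainst u = 0 := by
  subst hd
  have h : ∀ v : EuclideanSpace ℝ (Fin 1), ‖v‖ = 1 → outer v = 1 := by
    intro v hv
    have := dotProduct_self_of_norm hv
    ext i j
    fin_cases i; fin_cases j
    simpa [outer, vecMulVec_apply, dotProduct] using this
  refine Finset.sum_eq_zero fun t ht => ?_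
  have : (fun ω => frobInner (outer (X.played t ω) - outer u) (X.L t ω)) = fun _ => 0 := by
    ext ω
    rw [h _ (X.norm_played le_rfl (Finset.mem_range.mp ht) ω), h u hu]
    simp [frobInner]
  rw [this, integral_zero]

variable [IsProbabilityMeasure P]

lemma regretAgainst_le_two_mul (hd : 1 ≤ d) (X : Interaction d T η 0 P)
    {u : EuclideanSpace ℝ (Fin d)} (hu : ‖u‖ = 1) : X.regretAgainst u ≤ 2 * T := by
  calc X.regretAgainst u ≤ ∑ _t ∈ Finset.range T, (2 : ℝ) := by
        refine Finset.sum_le_sum fun t ht => ?_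
        have ht := Finset.mem_range.mp ht
        refine (le_abs_self _).trans ?_
        have := norm_integral_le_of_norm_le_const (μ := P) (C := 2)
          (f := fun ω => frobInner (outer (X.played t ω) - outer u) (X.L t ω))
          (Filter.Eventually.of_forall fun ω =>
            abs_frobInner_sub_le (X.norm_played hd ht ω) hu (X.loss_le_one t ht ω))
        simpa using this
    _ = 2 * T := by simp [mul_comm]

/-- The regret of one round, in terms of the estimated loss. -/
lemma integral_round_le (hd : 2 ≤ d) (hη : 0 < η) (hηd : η * d ≤ 1 / 2)
    (X : Interaction d T η 0 P) {t : ℕ} (ht : t < T) {ε : ℝ} (hε : 0 ≤ ε)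
    {u : EuclideanSpace ℝ (Fin d)} (hu : ‖u‖ = 1) :
    Integrable (fun ω => ((X.W t ω - smoothedOuter ε u) * X.estimate t ω).trace) P ∧
    ∫ ω, frobInner (outer (X.played t ω) - outer u) (X.L t ω) ∂P
      ≤ ∫ ω, ((X.W t ω - smoothedOuter ε u) * X.estimate t ω).trace ∂P + 2 * ε := by
  have hd1 : 1 ≤ d := by omega
  set l : Draw d → Ω → ℝ := fun x ω => coordLoss (X.eigval t ω)
    ((colMatrix (X.eigvec t ω))ᵀ * X.L t ω * colMatrix (X.eigvec t ω)) x with hl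
  -- True and estimated regret as functions of the draw. Averaging over the draw turns them into ⟨W
  -- - uuᵀ, L⟩ and ⟨W - U, L⟩, which differ by the smoothing cost.
  set g₁ : Draw d → Ω → ℝ := fun x ω => l x ω - frobInner (outer u) (X.L t ω) with hg₁
  set g₂ : Draw d → Ω → ℝ := fun x ω => frobInner (X.W t ω - smoothedOuter ε u)
    (invFactor (X.eigval t ω) (X.eigvec t ω) * whiteEstimate (l x ω) x *
      (invFactor (X.eigval t ω) (X.eigvec t ω))ᵀ) with hg₂
  have hlB : ∀ x, IsBddMeasurable (X.ℱ t) (l x) := X.isBddMeasurable_coordLoss hd1 ht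
  have hR := X.isBddMeasurable_invFactor hd hη hηd ht
  obtain ⟨-, i₁, e₁⟩ := X.integral_draw ht (g := g₁) fun x => (hlB x).sub
    (IsBddMeasurable.frobInner (fun i j => IsBddMeasurable.const _) (X.isBddMeasurable_loss ht))
  obtain ⟨j₂, i₂, e₂⟩ := X.integral_draw ht (g := g₂) fun x => IsBddMeasurable.frobInner
    (fun i j => (X.isBddMeasurable_density hd1 ht i j).sub (IsBddMeasurable.const _))
    (IsBddMeasurable.matrix_mul (IsBddMeasurable.matrix_mul hR
      (isBddMeasurable_whiteEstimate (hlB x) x)) fun i j => hR j i)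
  have hsymm : ∀ ω, (X.W t ω - smoothedOuter ε u)ᵀ = X.W t ω - smoothedOuter ε u := fun ω => by
    have : (X.W t ω)ᵀ = X.W t ω := (X.posDef_and_trace hd1 ht.le ω).1.1
    rw [transpose_sub, transpose_smoothedOuter, this]
  have f₁ : (fun ω => frobInner (outer (X.played t ω) - outer u) (X.L t ω))
      = fun ω => g₁ (X.draw t ω) ω := by
    ext ω
    simp only [hg₁, hl]
    rw [← frobInner_outer_playedVector, played_eq]
    simp [frobInner, sub_mul]
  have f₂ : (fun ω => ((X.W t ω - smoothedOuter ε u) * X.estimate t ω).trace)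
      = fun ω => g₂ (X.draw t ω) ω := by
    ext ω
    simp only [hg₂, hl]
    rw [estimate, played_eq, (X.eigendecomposition t ht ω).lossEstimate_eq
      (X.eigval_pos hd1 ht ω), ← frobInner_outer_playedVector]
    simp only [frobInner, hsymm]
  rw [f₁, f₂, e₁, e₂]
  refine ⟨j₂, ?_⟩
  have hc : ∫ _ω, 2 * ε ∂P = 2 * ε := by simp
  rw [← hc, ← integral_add i₂ (integrable_const _)]
  refine integral_mono i₁ (i₂.add (integrable_const _)) fun ω => ?_
  have hpos := X.eigval_pos hd1 ht ω
  have hed := X.eigendecomposition t ht ω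
  have s₁ : ∑ x, drawProb (X.eigval t ω) x * g₁ x ω
      = frobInner (X.W t ω) (X.L t ω) - frobInner (outer u) (X.L t ω) := by
    simp only [hg₁, hl, mul_sub, Finset.sum_sub_distrib, ← Finset.sum_mul,
      sum_drawProb (X.sum_eigval hd1 ht ω), one_mul]
    rw [sum_drawProb_mul_coordLoss fun i => (hpos i).le, hed.sum_eigval_mul]
  have s₂ : ∑ x, drawProb (X.eigval t ω) x * g₂ x ω
      = frobInner (X.W t ω - smoothedOuter ε u) (X.L t ω) :=
    sum_drawProb_mul_frobInner hed.1 hpos (hsymm ω) _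
  have s₃ := frobInner_smoothedOuter_sub_le hd1 hε hu (X.loss_le_one t ht ω)
  simp only [s₁, s₂]
  simp only [frobInner, transpose_sub, sub_mul, trace_sub] at s₃ ⊢
  linarith

lemma regretAgainst_le (hd : 2 ≤ d) (hη : 0 < η) (hηd : η * d ≤ 1 / 2) (hT : 1 ≤ T)
    (X : Interaction d T η 0 P) {u : EuclideanSpace ℝ (Fin d)} (hu : ‖u‖ = 1) :
    X.regretAgainst u ≤ d * Real.log T / η + 2 * η * d ^ 2 * T + 2 := by
  have hT' : (1 : ℝ) ≤ T := by exact_mod_cast hT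
  have hT0 : (0 : ℝ) < T := by linarith
  have hd1 : 1 ≤ d := by omega
  -- Weight 1/T makes the smoothing cost 2/T per round and the divergence from I/d at most d log T.
  set U := smoothedOuter (1 / T : ℝ) u with hU
  have hε : (0 : ℝ) < 1 / T := by positivity
  have hε1 : (1 / T : ℝ) ≤ 1 := (div_le_one hT0).mpr hT'
  have hround := fun t (ht : t < T) => X.integral_round_le hd hη hηd ht hε.le hu
  have h1 : X.regretAgainst u ≤ ∑ t ∈ Finset.range T,
      (∫ ω, ((X.W t ω - U) * X.estimate t ω).trace ∂P + 2 * (1 / T : ℝ)) :=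
    Finset.sum_le_sum fun t ht => (hround t (Finset.mem_range.mp ht)).2
  rw [Finset.sum_add_distrib, ← integral_finsetSum _ fun t ht =>
    (hround t (Finset.mem_range.mp ht)).1] at h1
  have h2 : ∑ _t ∈ Finset.range T, 2 * (1 / T : ℝ) = 2 := by
    simp; field_simp
  have hpath : ∀ ω, ∑ t ∈ Finset.range T, ((X.W t ω - U) * X.estimate t ω).trace
      ≤ d * Real.log T / η + 2 * η * d ^ 2 * T := fun ω => by
    have h3 := X.sum_trace_le hd hη hηd ω (posDef_smoothedOuter hd1 hε hε1 hu)
      (trace_smoothedOuter hd1 _ hu)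
    have h4 := logDetDiv_smoothedOuter_le hd1 hε hε1 hu
    rw [one_div (T : ℝ), Real.log_inv, neg_neg, ← one_div] at h4
    rw [X.init] at h3
    have h5 : d * Real.log T / η + 2 * η * d ^ 2 * T
        = (d * Real.log T + T * (2 * η ^ 2 * d ^ 2)) / η := by
      field_simp
    rw [h5, le_div_iff₀ hη, mul_comm]
    linarith
  have h6 : ∫ ω, ∑ t ∈ Finset.range T, ((X.W t ω - U) * X.estimate t ω).trace ∂P
      ≤ ∫ _ω, (d * Real.log T / η + 2 * η * d ^ 2 * T) ∂P :=
    integral_mono (integrable_finsetSum _ fun t ht => (hround t (Finset.mem_range.mp ht)).1)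
      (integrable_const _) hpath
  rw [integral_const, probReal_univ, one_smul] at h6
  linarith

/-- The regret bound for the tuned learning rate. -/
lemma regretAgainst_le_of_eq_min (hd : 1 ≤ d) (hT : 2 ≤ T)
    (hη : η = min (Real.sqrt (Real.log T / (d * T))) (1 / (2 * d)))
    (X : Interaction d T η 0 P) {u : EuclideanSpace ℝ (Fin d)} (hu : ‖u‖ = 1) :
    X.regretAgainst u ≤ 5 * (d : ℝ) ^ (3 / 2 : ℝ) * Real.sqrt (T * Real.log T) := by
  have hd' : (1 : ℝ) ≤ d := by exact_mod_cast hd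
  have hT' : (2 : ℝ) ≤ T := by exact_mod_cast hT
  have hlog : 1 / 2 ≤ Real.log T :=
    (by linarith [Real.log_two_gt_d9] : (1 : ℝ) / 2 ≤ Real.log 2).trans
      (Real.log_le_log two_pos hT')
  have hpow : (d : ℝ) ^ (3 / 2 : ℝ) = d * Real.sqrt d := by
    rw [show (3 / 2 : ℝ) = 1 + 1 / 2 by norm_num, Real.rpow_add (by linarith), Real.rpow_one,
      ← Real.sqrt_eq_rpow]
  have hs1 : 1 ≤ Real.sqrt d := Real.one_le_sqrt.mpr hd'
  -- T ≥ 2 and log T ≥ 1/2 put the target above 1, so that it absorbs the additive 2. The constant 5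
  -- is 1 + 2 + 2.
  have hr1 : 1 ≤ Real.sqrt (T * Real.log T) := Real.one_le_sqrt.mpr (by nlinarith)
  rw [hpow]
  rcases hd.eq_or_lt with h1 | h2
  · rw [X.regretAgainst_eq_zero h1.symm hu]; positivity
  have hd0 : (0 : ℝ) < d := by linarith
  have hT0 : (0 : ℝ) < T := by linarith
  set s := Real.sqrt (Real.log T / (d * T)) with hs
  set S := Real.sqrt (T * Real.log T) with hS
  have hs0 : 0 < s := Real.sqrt_pos.mpr (by positivity)
  have hsS : s * Real.sqrt d * T = S := by
    have hTT : Real.sqrt ((T : ℝ) ^ 2) = T := Real.sqrt_sq hT0.le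
    rw [← hTT, hs, ← Real.sqrt_mul (by positivity), ← Real.sqrt_mul (by positivity), hS]
    congr 1
    field_simp
  have hSS : S * S = T * Real.log T := Real.mul_self_sqrt (by positivity)
  have hdd : Real.sqrt d * Real.sqrt d = d := Real.mul_self_sqrt hd0.le
  have hdS : 1 ≤ d * Real.sqrt d * S :=
    one_le_mul_of_one_le_of_one_le (one_le_mul_of_one_le_of_one_le hd' hs1) hr1
  rcases le_or_gt s (1 / (2 * d)) with hmin | hmin
  · have hηd : s * d ≤ 1 / 2 := by
      rw [le_div_iff₀ (by positivity)] at hmin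
      linarith
    obtain rfl : η = s := hη.trans (min_eq_left hmin)
    have hbound := X.regretAgainst_le h2 hs0 hηd (by omega) hu
    have e1 : d * Real.log T / s = d * Real.sqrt d * S := by
      rw [div_eq_iff hs0.ne']
      have : T * (Real.log T) = T * (s * Real.sqrt d * S) := by
        linear_combination -hSS - S * hsS
      linear_combination (d : ℝ) * mul_left_cancel₀ hT0.ne' this
    have e2 : 2 * s * d ^ 2 * T = 2 * (d * Real.sqrt d * S) := by
      linear_combination 2 * d * Real.sqrt d * hsS - 2 * d * s * T * hdd
    rw [e1, e2] at hbound
    linarith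
  -- Here s > 1/(2d) forces √d T ≤ 2d S, so the trivial bound 2T is at most 4dS.
  · have h3 := X.regretAgainst_le_two_mul hd hu
    rw [div_lt_iff₀ (by positivity)] at hmin
    have h4 : Real.sqrt d * T ≤ S * (2 * d) := by
      rw [← hsS]
      have : 0 ≤ Real.sqrt d * T := by positivity
      nlinarith
    have h5 : (T : ℝ) ≤ Real.sqrt d * T := le_mul_of_one_le_left hT0.le hs1
    have h6 : S * d ≤ d * Real.sqrt d * S := by
      have : 0 ≤ S * d := by positivity
      nlinarith
    linarith

end Interaction

end BanditPCA

end

theorem corollary1 :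
    ∃ C : ℝ, 0 < C ∧ ∀ (d T : ℕ), 1 ≤ d → 2 ≤ T →
      ∀ {Ω : Type*} [MeasurableSpace Ω] (P : MeasureTheory.Measure Ω)
        [MeasureTheory.IsProbabilityMeasure P]
        (X : BanditPCA.Interaction d T
          (min (Real.sqrt (Real.log T / (d * T))) (1 / (2 * d))) 0 P),
        X.regret ≤ C * (d : ℝ) ^ (3 / 2 : ℝ) * Real.sqrt (T * Real.log T) := by
  refine ⟨5, by norm_num, fun d T hd hT Ω _ P _ X => ?_⟩
  -- Nonnegativity of the bound is required because a real supremum over an empty family is 0 by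
  -- default.
  refine Real.iSup_le (fun u => ?_) (by positivity)
  exact X.regretAgainst_le_of_eq_min hd hT rfl (by simp)
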